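/- **Theorem (privacy of advanced dp-GAN).** There is an absolute constant $K>0$ such that the following holds. Let $D_w(x)$ be a discriminator, $G_\theta(z)$ a generator, let $\mathcal D_{\rm pub}$ be a nonempty public dataset, and consider the following algorithm on a private dataset $d=(d_1,\dots,d_n)$, $n\ge 1$, with hyper-parameters $m\ge1$ (batch size), $m_{\rm pub}$ (public batch size), $k\ge 1$ (number of groups), $n_{\rm critic}$, noise scale $\sigma$, gradient-penalty coefficient $\lambda$, and Adam parameters. *Warm start.* Obtain $(w,\theta)$ by training an ordinary improved WGAN for a fixed number of iterations on $\mathcal D_{\rm pub}$ only. *Main loop.* Each iteration makes $n_{\rm critic}$ discriminator updates and then one Adam update of $\theta$ with the gradient $\nabla_\theta\frac1m\sum_{i=1}^m -D_w(G_\theta(z_i))$, $z_i\sim p_z$ independent. A discriminator update is made as follows. 1. Draw $m_{\rm pub}$ public samples uniformly and independently, and compute their gradients $\bar g^{(l)}=\nabla_w\ell$ of the loss $\ell = D_w(G_\theta(z))-D_w(x)+\lambda(\|\nabla D_w(\hat x)\|_2-1)^2$, where $\hat x=\rho x+(1-\rho)G_\theta(z)$, $z\sim p_z$, $\rho\sim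 U[0,1]$. The clipping bound of the $i$-th parameter is the average of $|\bar g_i^{(l)}|$ over $l$. 2. Starting with every parameter as its own group, repeatedly merge two groups with bounds $c,c'$ for which $\max(c/c',c'/c)$ is smallest, giving the merged group the bound $\sqrt{c^2+c'^2}$, until at most $k$ groups $G_j$, with bounds $c_j$, are left. 3. Draw $m$ private samples uniformly and independently from $d$, and compute their gradients $g^{(i)}=\nabla_w\ell$ in the same way. For every $i$ and $j$, replace the part $g^{(i)}_j$ of $g^{(i)}$ in $G_j$ by $g_j^{(i)}/\max(1,\|g_j^{(i)}\|_2/c_j)+\xi$, with independent $\xi\sim\mathcal N(0,(\sigma c_j)^2 I)$ (a group with $c_j=0$ is replaced by $0$). 4. Update $w$ by Adam with $\frac1m\sum_{i=1}^m g^{(i)}$. The loop is left when a convergence criterion on the network states before and after an iteration holds, or when a privacy accountant, whose report depends only on $\sigma$, $m$, $k$, the number of updates made and the target $\epsilon_0$, reports $\delta\ge\delta_0$; it makes at most $t$ iterations. The output is the generator's parameter $\theta$. All gradients and the convergence criterion are assumed measurable. Let $q=m/n$, $T=n_{\rm critic}\,t$ (the maximal number of discriminator updates), $\epsilon>0$,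 $0<\delta<1$, and suppose that the noise scale satisfies $$\sigma\;\ge\;\max\left\{\sqrt{k}\,\sqrt{2\log(1.25/\delta)},\quad \sqrt{\tfrac km}\;\frac{\sqrt{2\log(1.25/\delta)}}{\epsilon},\quad \sqrt{\tfrac km}\,\sqrt{\frac{q\sqrt T}{\epsilon}}\right\}.$$ Then the algorithm is a well-defined randomized mechanism (its output law is a probability measure for every $d$), and it is $(K\,q\,\epsilon\sqrt{T},\,\delta)$-differentially private: for all datasets $d,d'$ of size $n$ that are identical except for one single entry, and every measurable set $S$, $\Pr[\theta(d)\in S]\le e^{K q\epsilon\sqrt T}\Pr[\theta(d')\in S]+\delta$. In particular, the choice $\sigma=\sqrt{2\log(1.25/\delta)}/\epsilon$ is admissible whenever $k\le m$, $k\epsilon^2\le 1$ and $q\epsilon\sqrt T\le 2\log(1.25/\delta)$. -/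

import Mathlib

open MeasureTheory ProbabilityTheory

noncomputable section

namespace DPGAN

/-! ### Differential privacy -/

/-- Two databases are adjacent if they agree except for (at most) one single data entry. -/
def Adjacent {X : Type*} {n : ℕ} (d d' : Fin n → X) : Prop :=
  ∃ i, ∀ j, j ≠ i → d j = d' j

/-- `(ε, δ)`-differential privacy of a randomized mechanism, given by its output laws. -/
def IsDP {X R : Type*} [MeasurableSpace R] {n : ℕ} (M : (Fin n → X) → Measure R) (ε δ : ℝ) :
    Prop :=
  ∀ d d' : Fin n → X, Adjacent d d' → ∀ S : Set R, MeasurableSet S →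
    M d S ≤ ENNReal.ofReal (Real.exp ε) * M d' S + ENNReal.ofReal δ

/-! ### Adam -/

abbrev Vec (d : ℕ) : Type := EuclideanSpace ℝ (Fin d)

/-- First moment estimate, second moment estimate, number of steps made. -/
abbrev AdamState (d : ℕ) : Type := Vec d × Vec d × ℕ

/-- Step size `α`, decay rates `β₁`, `β₂`, and the stabilizer in the denominator. -/
structure AdamParams where
  α : ℝ
  β₁ : ℝ
  β₂ : ℝ
  stab : ℝ

/-- One Adam step with gradient `g`. It acts coordinate by coordinate, so that running it on every
group of coordinates separately is the same as running it on the whole vector. -/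
def adamStep {d : ℕ} (a : AdamParams) (g : Vec d) (s : Vec d × AdamState d) :
    Vec d × AdamState d :=
  let M : Vec d := WithLp.toLp 2 fun i => a.β₁ * s.2.1 i + (1 - a.β₁) * g i
  let V : Vec d := WithLp.toLp 2 fun i => a.β₂ * s.2.2.1 i + (1 - a.β₂) * g i ^ 2
  let c : ℕ := s.2.2.2 + 1
  (WithLp.toLp 2 fun i =>
      s.1 i - a.α * (M i / (1 - a.β₁ ^ c)) / (√(V i / (1 - a.β₂ ^ c)) + a.stab),
    M, V, c)

def adamInit (d : ℕ) : AdamState d := (0, 0, 0)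

/-! ### Weight clustering -/

/-- A grouping of the coordinates `Fin P`: every coordinate is labelled by a representative of its
group (a fixed point of the labelling), and every representative carries the clipping bound of its
group (the bounds at the other coordinates are not used). -/
abbrev Grouping (P : ℕ) : Type := (Fin P → Fin P) × (Fin P → ℝ)

/-- Dissimilarity `max (c(G) / c(G'), c(G') / c(G))`; a positive bound divided by the bound `0`
is `∞`, and two groups with bound `0` are as similar as possible. -/
def dissimilarity {P : ℕ} (c : Fin P → ℝ) (p : Fin P × Fin P) : ENNReal :=
  max (ENNReal.ofReal (c p.1) / ENNReal.ofReal (c p.2))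
    (ENNReal.ofReal (c p.2) / ENNReal.ofReal (c p.1))

/-- All pairs of distinct groups, in lexicographic order of their representatives. -/
def groupPairs {P : ℕ} (lab : Fin P → Fin P) : List (Fin P × Fin P) :=
  ((List.finRange P).product (List.finRange P)).filter
    fun p => decide (p.1 < p.2 ∧ lab p.1 = p.1 ∧ lab p.2 = p.2)

/-- Merge two most similar groups (the first such pair), with new bound `√(c(G)² + c(G')²)`. -/
def mergeStep {P : ℕ} (𝒢 : Grouping P) : Grouping P :=
  match (groupPairs 𝒢.1).argmin (dissimilarity 𝒢.2) with
  | none => 𝒢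
  | some p =>
      (fun i => if 𝒢.1 i = p.2 then p.1 else 𝒢.1 i,
        Function.update 𝒢.2 p.1 (√(𝒢.2 p.1 ^ 2 + 𝒢.2 p.2 ^ 2)))

/-- Start with the singletons and merge until at most `k` groups are left. Every merger lowers the
number of groups by one, so `P - k` mergers are made. -/
def weightClustering {P : ℕ} (k : ℕ) (c : Fin P → ℝ) : Grouping P :=
  mergeStep^[P - k] (id, c)

/-- Parameter-specific clipping bounds: average magnitude of the gradient over a batch. -/
def paramBounds {P b : ℕ} (g : Fin b → Vec P) (i : Fin P) : ℝ :=
  (∑ l, |g l i|) / b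

/-- The `ℓ²` norm of the part of `g` in the group with representative `j`. -/
def groupNorm {P : ℕ} (𝒢 : Grouping P) (g : Vec P) (j : Fin P) : ℝ :=
  √(∑ i with 𝒢.1 i = j, g i ^ 2)

/-- Group-wise clipping `g_j / max (1, ‖g_j‖ / c_j)`; a group with `c_j = 0` is clipped to `0`
(the limit as `c_j → 0`). -/
def groupClip {P : ℕ} (𝒢 : Grouping P) (g : Vec P) : Vec P :=
  WithLp.toLp 2 fun i =>
    if 𝒢.2 (𝒢.1 i) = 0 then 0
    else g i / max 1 (groupNorm 𝒢 g (𝒢.1 i) / 𝒢.2 (𝒢.1 i))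

/-- Group-wise clipping and perturbation, where `ξ` is standard normal noise: the noise added to
the group `j` is `N(0, (σ c_j)² I)`. -/
def groupClipPerturb {P : ℕ} (σ : ℝ) (𝒢 : Grouping P) (g : Vec P) (ξ : Fin P → ℝ) : Vec P :=
  WithLp.toLp 2 fun i => groupClip 𝒢 g i + σ * 𝒢.2 (𝒢.1 i) * ξ i

/-! ### The algorithm -/

/-- Weights and optimizer states of the discriminator and of the generator. -/
abbrev NetState (dW dΘ : ℕ) : Type := (Vec dW × AdamState dW) × (Vec dΘ × AdamState dΘ)

/-- Networks, hyper-parameters and stopping rules. Samples live in `Vec dX`, the parameters of the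
discriminator in `Vec dW`, those of the generator in `Vec dΘ`, latent variables in `Vec dZ`. -/
structure Config (dX dW dΘ dZ : ℕ) where
  /-- discriminator `D_w(x)` -/
  disc : Vec dW → Vec dX → ℝ
  /-- generator `G_θ(z)` -/
  gen : Vec dΘ → Vec dZ → Vec dX
  /-- the distribution of the latent variable `z` -/
  latent : Measure (Vec dZ)
  /-- random initialization of `(w, θ)` before the warm start -/
  init : Measure (Vec dW × Vec dΘ)
  /-- coefficient of the gradient penalty -/
  penalty : ℝ
  adam : AdamParams
  /-- number of critic iterations per generator iteration -/
  nCritic : ℕ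
  /-- batch size for training -/
  m : ℕ
  /-- batch size for estimating clipping bounds -/
  mPub : ℕ
  /-- number of parameter groups -/
  k : ℕ
  /-- noise scale -/
  σ : ℝ
  /-- number of warm starting iterations -/
  tWarm : ℕ
  ε₀ : ℝ
  δ₀ : ℝ
  /-- the value of `δ` that the privacy accountant reports for `ε₀` after a number of updates with
  `(σ, m, k)`; arguments `σ`, `m`, `k`, number of updates, `ε₀` -/
  accountant : ℝ → ℕ → ℕ → ℕ → ℝ → ℝ
  /-- convergence criterion, on the states before and after an iteration of the main loop -/
  converged : Set (NetState dW dΘ × NetState dW dΘ)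

/-- Law after `j` rounds, each of which moves from `s` to a random state with law `κ s`. -/
def iterateLaw {S : Type*} [MeasurableSpace S] (κ : S → Measure S) : ℕ → S → Measure S
  | 0, s => Measure.dirac s
  | j + 1, s => (iterateLaw κ j s).bind κ

/-- The random choices for a batch of size `b` from `N` samples: for each of its members the
(index of the) sample `x`, the latent variable `z` and the interpolation coefficient `ρ`. -/
abbrev BatchSeed (N b dZ : ℕ) : Type := Fin b → Fin N × Vec dZ × ℝ

/-- Members of a batch are drawn independently, with `x` uniform, `z ∼ p_z`, `ρ ∼ U[0, 1]`. -/
def batchLaw (N b : ℕ) {dZ : ℕ} (pz : Measure (Vec dZ)) : Measure (BatchSeed N b dZ) :=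
  Measure.pi fun _ =>
    (uniformOn (Set.univ : Set (Fin N))).prod (pz.prod (volume.restrict (Set.Icc (0 : ℝ) 1)))

def noiseLaw (b P : ℕ) : Measure (Fin b → Fin P → ℝ) :=
  Measure.pi fun _ => Measure.pi fun _ => gaussianReal 0 1

variable {dX dW dΘ dZ : ℕ}

/-- Loss of the improved WGAN for one real sample `x`, as a function of `w`. -/
def Config.loss (A : Config dX dW dΘ dZ) (θ : Vec dΘ) (x : Vec dX) (z : Vec dZ) (ρ : ℝ)
    (w : Vec dW) : ℝ :=
  A.disc w (A.gen θ z) - A.disc w x +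
    A.penalty * (‖gradient (A.disc w) (ρ • x + (1 - ρ) • A.gen θ z)‖ - 1) ^ 2

/-- The gradient `∇_w ℓ` of the discriminator's loss for one real sample `x`. -/
def Config.wganGrad (A : Config dX dW dΘ dZ) (w : Vec dW) (θ : Vec dΘ) (x : Vec dX) (z : Vec dZ)
    (ρ : ℝ) : Vec dW :=
  gradient (A.loss θ x z ρ) w

/-- The procedure `Improved WGAN-Gradient` on a batch from `data`. -/
def Config.batchGrads (A : Config dX dW dΘ dZ) {N b : ℕ} (data : Fin N → Vec dX) (w : Vec dW)
    (θ : Vec dΘ) (seed : BatchSeed N b dZ) (i : Fin b) : Vec dW :=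
  A.wganGrad w θ (data (seed i).1) (seed i).2.1 (seed i).2.2

/-- The gradient `∇_θ (1/m) ∑ᵢ -D(G(zᵢ))` of the generator. -/
def Config.genGrad (A : Config dX dW dΘ dZ) (w : Vec dW) (θ : Vec dΘ) (z : Fin A.m → Vec dZ) :
    Vec dΘ :=
  gradient (fun θ' => (1 / (A.m : ℝ)) * ∑ i, -A.disc w (A.gen θ' (z i))) θ

/-- Law of the state after one update of the generator. -/
def Config.genLaw (A : Config dX dW dΘ dZ) (s : NetState dW dΘ) : Measure (NetState dW dΘ) :=
  (Measure.pi fun _ : Fin A.m => A.latent).map fun z =>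
    (s.1, adamStep A.adam (A.genGrad s.1.1 s.2.1 z) s.2)

/-- One update of the discriminator on data without privacy protection. -/
def Config.plainCriticStep (A : Config dX dW dΘ dZ) {N : ℕ} (data : Fin N → Vec dX)
    (s : NetState dW dΘ) (seed : BatchSeed N A.m dZ) : NetState dW dΘ :=
  (adamStep A.adam ((1 / (A.m : ℝ)) • ∑ i, A.batchGrads data s.1.1 s.2.1 seed i) s.1, s.2)

/-- Warm starting: law of `(w, θ)` after training a regular improved WGAN on public data. -/
def Config.warmStart (A : Config dX dW dΘ dZ) {nPub : ℕ} (pub : Fin nPub → Vec dX) :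
    Measure (Vec dW × Vec dΘ) :=
  (A.init.bind fun p =>
    iterateLaw
      (fun s => (iterateLaw
        (fun s' => (batchLaw nPub A.m A.latent).map (A.plainCriticStep pub s'))
        A.nCritic s).bind A.genLaw)
      A.tWarm ((p.1, adamInit dW), (p.2, adamInit dΘ))).map fun s => (s.1.1, s.2.1)

/-- The clipping groups and bounds of one critic iteration, computed from a public batch. -/
def Config.grouping (A : Config dX dW dΘ dZ) {nPub : ℕ} (pub : Fin nPub → Vec dX) (w : Vec dW)
    (θ : Vec dΘ) (seed : BatchSeed nPub A.mPub dZ) : Grouping dW :=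
  weightClustering A.k (paramBounds (A.batchGrads pub w θ seed))

/-- One critic iteration, given all its random choices: the public batch, the private batch, and
independent standard normal noise for every member of the private batch. -/
def Config.criticStep (A : Config dX dW dΘ dZ) {nPub n : ℕ} (pub : Fin nPub → Vec dX)
    (data : Fin n → Vec dX) (s : NetState dW dΘ)
    (ω : BatchSeed nPub A.mPub dZ × BatchSeed n A.m dZ × (Fin A.m → Fin dW → ℝ)) :
    NetState dW dΘ :=
  (adamStep A.adam ((1 / (A.m : ℝ)) • ∑ i,
      groupClipPerturb A.σ (A.grouping pub s.1.1 s.2.1 ω.1)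
        (A.batchGrads data s.1.1 s.2.1 ω.2.1 i) (ω.2.2 i)) s.1,
    s.2)

/-- Law of the state after one critic iteration. -/
def Config.criticLaw (A : Config dX dW dΘ dZ) {nPub n : ℕ} (pub : Fin nPub → Vec dX)
    (data : Fin n → Vec dX) (s : NetState dW dΘ) : Measure (NetState dW dΘ) :=
  ((batchLaw nPub A.mPub A.latent).prod
    ((batchLaw n A.m A.latent).prod (noiseLaw A.m dW))).map (A.criticStep pub data s)

/-- State of the main loop: the networks, the number of updates of the privacy accountant, and
whether the loop has been left. -/
abbrev LoopState (dW dΘ : ℕ) : Type := NetState dW dΘ × ℕ × Bool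

open Classical in
/-- One iteration of the main loop: `nCritic` critic iterations, an update of the generator, and
the decision whether to leave the loop (convergence, or privacy budget used up). Nothing happens
after the loop has been left. -/
def Config.loopLaw (A : Config dX dW dΘ dZ) {nPub n : ℕ} (pub : Fin nPub → Vec dX)
    (data : Fin n → Vec dX) (s : LoopState dW dΘ) : Measure (LoopState dW dΘ) :=
  if s.2.2 then Measure.dirac s
  else ((iterateLaw (A.criticLaw pub data) A.nCritic s.1).bind A.genLaw).map fun s' =>
    (s', s.2.1 + A.nCritic,
      decide ((s.1, s') ∈ A.converged ∨
        A.δ₀ ≤ A.accountant A.σ A.m A.k (s.2.1 + A.nCritic) A.ε₀))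

/-- Advanced dp-GAN: law of the generator that is returned when the main loop makes (at most) `t`
iterations. -/
def Config.advancedDPGAN (A : Config dX dW dΘ dZ) {nPub n : ℕ} (pub : Fin nPub → Vec dX) (t : ℕ)
    (data : Fin n → Vec dX) : Measure (Vec dΘ) :=
  ((A.warmStart pub).bind fun p =>
    iterateLaw (A.loopLaw pub data) t
      (((p.1, adamInit dW), (p.2, adamInit dΘ)), 0, false)).map fun s => s.1.2.1

/-- The standing regularity of a configuration: genuine distributions, nontrivial batches and at
least one group, and measurability of gradients and of the convergence criterion. -/
structure Config.Regular (A : Config dX dW dΘ dZ) : Prop where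
  latent_prob : IsProbabilityMeasure A.latent
  init_prob : IsProbabilityMeasure A.init
  m_pos : 0 < A.m
  k_pos : 0 < A.k
  measurable_wganGrad : Measurable
    fun p : Vec dW × Vec dΘ × Vec dX × Vec dZ × ℝ =>
      A.wganGrad p.1 p.2.1 p.2.2.1 p.2.2.2.1 p.2.2.2.2
  measurable_genGrad : Measurable
    fun p : Vec dW × Vec dΘ × (Fin A.m → Vec dZ) => A.genGrad p.1 p.2.1 p.2.2
  measurable_converged : MeasurableSet A.converged

end DPGAN

end

/-!
The output law is compared, for two adjacent data sets, through the relation `RenyiClose p C η`: a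
Hölder inequality for tests `g ≤ 1` that expresses an approximate Rényi divergence bound of the
order `α` conjugate to `p`. It survives post-processing (`RenyiClose.map`), adaptive composition
(`RenyiClose.bind`: the factors multiply, the errors add) and mixtures, and it yields
differential privacy (`RenyiClose.measure_le`).

Instead of one mechanism per critic iteration, consider one per member of a private batch. In units
of the standard deviation of its noise, the clipped gradient of a member has squared norm at most
`k / σ² = 1 / s²`, because there are at most `k` groups, each of norm at most its bound
(`sum_sq_scaledClip_le`). The rest of a critic iteration, the public batch included, is mixing and
post-processing, so that the algorithm composes `N = m * nCritic * t` Gaussian mechanisms of noise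
multiplier `s`, each of which meets the changed entry with probability `q' = 1 / n`
(`renyiClose_advancedDPGAN`). With `ε' = √m ε` and `L² = 2 log (1.25 / δ)` the assumptions on `σ`
become `s ≥ L`, `ε' s ≥ L` and `ε' s² ≥ q' √N`, and `q ε √T` is `E = q' ε' √N`.

After conditioning on the alternative draw and centering at it, a step compares the mixture
`(1 - q') N(0, I) + q' N(a, I)` with `(1 - q') N(0, I) + q' N(b, I)`. In the moment of order `α` of
their likelihood ratio, the linear term has mean zero and the remainder is of order `(α q' / s)²`
(`mul_div_rpow_le`). For `α = 2` this is immediate. For large `α` the moment itself may be huge,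
owing to rare large values of the density `F` of `N(a, I)` with respect to `N(0, I)`. So the event
is discarded where `F` exceeds both a multiple of `√N` and the density of `N(b, I)`, at the cost of
an additive error of order `δ / N`. The linear term is nonnegative there, hence it may be dropped
(`renyiClose_gaussMix_large`).

After `N` steps the moment is `exp (O(E))` for `α = 2`, which suffices if `E` is at least of the
order of `L²`. Otherwise `α = 2 c L² / E` gives `α q' √N / s = 2 c L² / (ε' s) ≤ 2 c L`, so that the
moment is `exp (O(L²))`, while `(α - 1) K E` is a large multiple of `L²`. In both cases the mass
where the privacy loss exceeds `K E` is at most `δ / 2` (`exists_renyiClose_gaussMix`).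
-/

namespace DPGAN

open scoped ENNReal

/-! ### A divergence bound in Hölder form -/

/-- `RenyiClose p C η P Q` bounds `P`-expectations of tests `g ≤ 1` by the `p`-th moment of `g`
under `Q`, up to the factor `C` and the additive error `η`. If `p` is the conjugate exponent of `α`,
then by Hölder's inequality this holds as soon as `P` agrees, up to an event of probability `η`,
with a measure whose density `f` with respect to `Q` satisfies `∫ f ^ α ∂Q ≤ C ^ α`; so it is an
approximate Rényi divergence bound that does not mention densities. -/
def RenyiClose {Ω : Type*} [MeasurableSpace Ω] (p : ℝ) (C η : ℝ≥0∞) (P Q : Measure Ω) : Prop :=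
  ∀ g : Ω → ℝ≥0∞, Measurable g → (∀ x, g x ≤ 1) →
    ∫⁻ x, g x ∂P ≤ C * (∫⁻ x, g x ^ p ∂Q) ^ (1 / p) + η

section RenyiClose

variable {Ω Ω' : Type*} [MeasurableSpace Ω] [MeasurableSpace Ω'] {p : ℝ} {C C' η η' : ℝ≥0∞}

lemma RenyiClose.mono {P Q : Measure Ω} (h : RenyiClose p C η P Q) (hC : C ≤ C') (hη : η ≤ η') :
    RenyiClose p C' η' P Q := fun g hg h1 =>
  (h g hg h1).trans (by gcongr)

lemma lintegral_le_rpow_lintegral_rpow (hp : 1 ≤ p) (P : Measure Ω) [IsProbabilityMeasure P]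
    {g : Ω → ℝ≥0∞} (hg : Measurable g) : ∫⁻ x, g x ∂P ≤ (∫⁻ x, g x ^ p ∂P) ^ (1 / p) := by
  have := eLpNorm'_le_eLpNorm'_of_exponent_le (μ := P) (f := g) zero_lt_one hp
    hg.aestronglyMeasurable
  simpa [eLpNorm'] using this

lemma RenyiClose.refl (hp : 1 ≤ p) (P : Measure Ω) [IsProbabilityMeasure P] :
    RenyiClose p 1 0 P P := fun g hg _ => by
  simpa using lintegral_le_rpow_lintegral_rpow hp P hg

/-- Post-processing. -/
lemma RenyiClose.map {P Q : Measure Ω} (h : RenyiClose p C η P Q) {f : Ω → Ω'}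
    (hf : Measurable f) : RenyiClose p C η (P.map f) (Q.map f) := fun g hg h1 => by
  rw [lintegral_map hg hf, lintegral_map (by fun_prop) hf]
  exact h _ (hg.comp hf) fun _ => h1 _

/-- Adaptive composition. The additive errors add up because the inner bound may be truncated at `1`
before it serves as a test for the outer measures. -/
lemma RenyiClose.bind (hp : 1 ≤ p) {P Q : Measure Ω} [IsProbabilityMeasure P]
    (h : RenyiClose p C η P Q) {κ κ' : Ω → Measure Ω'} (hκ : Measurable κ) (hκ' : Measurable κ')
    (hprob : ∀ x, IsProbabilityMeasure (κ x)) (hκκ' : ∀ x, RenyiClose p C' η' (κ x) (κ' x)) :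
    RenyiClose p (C * C') (η + η') (P.bind κ) (Q.bind κ') := fun g hg h1 => by
  have hp0 : 0 < p := by linarith
  rw [Measure.lintegral_bind hκ.aemeasurable (by fun_prop),
    Measure.lintegral_bind hκ'.aemeasurable (by fun_prop)]
  have hgp : Measurable fun x => ∫⁻ y, g y ^ p ∂κ' x :=
    (Measure.measurable_lintegral (f := fun y => g y ^ p) (by fun_prop)).comp hκ'
  set H : Ω → ℝ≥0∞ := fun x => C' * (∫⁻ y, g y ^ p ∂κ' x) ^ (1 / p)
  have hH : Measurable H := by fun_prop
  have hin : ∀ x, ∫⁻ y, g y ∂κ x ≤ min 1 (H x) + η' := fun x => by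
    have hle : ∫⁻ y, g y ∂κ x ≤ 1 := by
      have := hprob x
      calc ∫⁻ y, g y ∂κ x ≤ ∫⁻ _, 1 ∂κ x := lintegral_mono h1
        _ = 1 := by simp
    rcases le_total 1 (H x) with h' | h'
    · rw [min_eq_left h']
      exact hle.trans le_self_add
    · rw [min_eq_right h']
      exact hκκ' x g hg h1
  calc ∫⁻ x, ∫⁻ y, g y ∂κ x ∂P ≤ ∫⁻ x, (min 1 (H x) + η') ∂P := lintegral_mono hin
    _ = ∫⁻ x, min 1 (H x) ∂P + η' := by
      rw [lintegral_add_right _ measurable_const]; simp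
    _ ≤ C * (∫⁻ x, min 1 (H x) ^ p ∂Q) ^ (1 / p) + η + η' := by
      gcongr
      exact h _ (by fun_prop) fun x => min_le_left _ _
    _ ≤ C * (∫⁻ x, C' ^ p * ∫⁻ y, g y ^ p ∂κ' x ∂Q) ^ (1 / p) + η + η' := by
      gcongr with x
      calc min 1 (H x) ^ p ≤ H x ^ p := by gcongr; exact min_le_right _ _
        _ = _ := by
          simp only [H]
          rw [ENNReal.mul_rpow_of_nonneg _ _ hp0.le, ← ENNReal.rpow_mul, one_div,
            inv_mul_cancel₀ hp0.ne', ENNReal.rpow_one]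
    _ = C * C' * (∫⁻ x, ∫⁻ y, g y ^ p ∂κ' x ∂Q) ^ (1 / p) + (η + η') := by
      rw [lintegral_const_mul _ hgp, ENNReal.mul_rpow_of_nonneg _ _ (by positivity),
        ← ENNReal.rpow_mul, one_div, mul_inv_cancel₀ hp0.ne', ENNReal.rpow_one, mul_assoc,
        add_assoc]

/-- Mixtures with the same mixing distribution. -/
lemma RenyiClose.mixture (hp : 1 ≤ p) (ν : Measure Ω) [IsProbabilityMeasure ν]
    {κ κ' : Ω → Measure Ω'} (hκ : Measurable κ) (hκ' : Measurable κ')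
    (hprob : ∀ x, IsProbabilityMeasure (κ x)) (h : ∀ x, RenyiClose p C η (κ x) (κ' x)) :
    RenyiClose p C η (ν.bind κ) (ν.bind κ') := by
  simpa using (RenyiClose.refl hp ν).bind hp hκ hκ' hprob h

lemma RenyiClose.prod (hp : 1 ≤ p) {P Q : Measure Ω} {P' Q' : Measure Ω'} [IsProbabilityMeasure P]
    [IsProbabilityMeasure P'] [SFinite Q'] (h : RenyiClose p C η P Q)
    (h' : RenyiClose p C' η' P' Q') :
    RenyiClose p (C * C') (η + η') (P.prod P') (Q.prod Q') := by
  rw [Measure.prod_def, Measure.prod_def]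
  refine h.bind hp Measurable.map_prodMk_left Measurable.map_prodMk_left
    (fun x => Measure.isProbabilityMeasure_map (by fun_prop)) fun x => h'.map (by fun_prop)

lemma RenyiClose.pi (hp : 1 ≤ p) {P Q : Measure Ω} [IsProbabilityMeasure P]
    [IsProbabilityMeasure Q] (h : RenyiClose p C η P Q) (b : ℕ) :
    RenyiClose p (C ^ b) (b * η) (Measure.pi fun _ : Fin b => P) (Measure.pi fun _ => Q) := by
  induction b with
  | zero =>
    have : (Measure.pi fun _ : Fin 0 => P) = Measure.pi fun _ => Q := by
      rw [Measure.pi_of_empty, Measure.pi_of_empty]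
    rw [this]
    simpa using RenyiClose.refl hp (Measure.pi fun _ : Fin 0 => Q)
  | succ b ih =>
    have e : ∀ R : Measure Ω, IsProbabilityMeasure R → (Measure.pi fun _ : Fin (b + 1) => R) =
        (R.prod (Measure.pi fun _ : Fin b => R)).map
          (MeasurableEquiv.piFinSuccAbove (fun _ => Ω) 0).symm := fun R _ =>
      (measurePreserving_piFinSuccAbove (fun _ : Fin (b + 1) => R) 0).symm.map_eq.symm
    rw [e P inferInstance, e Q inferInstance]
    refine ((h.prod hp ih).map (MeasurableEquiv.measurable _)).mono ?_ ?_
    · rw [pow_succ']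
    · rw [Nat.cast_succ, add_mul, one_mul, add_comm]

lemma measurable_iterateLaw {κ : Ω → Measure Ω} (hκ : Measurable κ) (j : ℕ) :
    Measurable (iterateLaw κ j) := by
  induction j with
  | zero => exact Measure.measurable_dirac
  | succ j ih => exact (Measure.measurable_bind' hκ).comp ih

lemma isProbabilityMeasure_bind {P : Measure Ω} [IsProbabilityMeasure P] {κ : Ω → Measure Ω'}
    (hκ : Measurable κ) (h : ∀ x, IsProbabilityMeasure (κ x)) :
    IsProbabilityMeasure (P.bind κ) := ⟨by
  rw [Measure.bind_apply .univ hκ.aemeasurable]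
  simp⟩

lemma isProbabilityMeasure_iterateLaw {κ : Ω → Measure Ω} (hκ : Measurable κ)
    (h : ∀ x, IsProbabilityMeasure (κ x)) (j : ℕ) (x : Ω) :
    IsProbabilityMeasure (iterateLaw κ j x) := by
  induction j with
  | zero => exact Measure.dirac.isProbabilityMeasure
  | succ j ih => exact isProbabilityMeasure_bind hκ h

lemma RenyiClose.iterateLaw (hp : 1 ≤ p) {κ κ' : Ω → Measure Ω} (hκ : Measurable κ)
    (hκ' : Measurable κ') (hprob : ∀ x, IsProbabilityMeasure (κ x))
    (h : ∀ x, RenyiClose p C η (κ x) (κ' x)) (j : ℕ) (x : Ω) :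
    RenyiClose p (C ^ j) (j * η) (iterateLaw κ j x) (iterateLaw κ' j x) := by
  induction j with
  | zero => simpa [DPGAN.iterateLaw] using RenyiClose.refl hp (Measure.dirac x)
  | succ j ih =>
    have := isProbabilityMeasure_iterateLaw hκ hprob j x
    refine (ih.bind hp hκ hκ' hprob h).mono ?_ ?_
    · rw [pow_succ]
    · rw [Nat.cast_succ, add_mul, one_mul]

/-- Hölder's inequality turns a bound on the `α`-th moment of a density, restricted to a likely
event, into `RenyiClose`. -/
lemma RenyiClose.of_density {α : ℝ} (hpα : α.HolderConjugate p) {γ : Measure Ω}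
    {f h : Ω → ℝ≥0∞} (hf : Measurable f) (hh : Measurable h) (hh0 : ∀ x, h x ≠ 0)
    (hht : ∀ x, h x ≠ ∞) {A : Set Ω} (hA : MeasurableSet A)
    (hC : ∫⁻ x in A, (f x / h x) ^ α * h x ∂γ ≤ C ^ α) (hη : γ.withDensity f Aᶜ ≤ η) :
    RenyiClose p C η (γ.withDensity f) (γ.withDensity h) := fun g hg h1 => by
  rw [← lintegral_add_compl _ hA]
  refine add_le_add ?_ ?_
  · have e : ∫⁻ x in A, g x ∂γ.withDensity f =
        ∫⁻ x, (A.indicator fun x => f x / h x) x * g x ∂γ.withDensity h := by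
      rw [← lintegral_indicator hA, lintegral_withDensity_eq_lintegral_mul _ hf (hg.indicator hA),
        lintegral_withDensity_eq_lintegral_mul _ hh
          (g := fun x => A.indicator (fun x => f x / h x) x * g x)
          (((hf.div hh).indicator hA).mul hg)]
      refine lintegral_congr fun x => ?_
      by_cases hx : x ∈ A
      · simp only [Pi.mul_apply, Set.indicator_of_mem hx]
        rw [← mul_assoc, ENNReal.mul_div_cancel (hh0 x) (hht x)]
      · simp [hx]
    rw [e]
    refine (ENNReal.lintegral_mul_le_Lp_mul_Lq _ hpα ((hf.div hh).indicator hA).aemeasurable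
      hg.aemeasurable).trans ?_
    have hCα : (C ^ α) ^ (1 / α) = C := by
      rw [← ENNReal.rpow_mul, mul_one_div_cancel hpα.ne_zero, ENNReal.rpow_one]
    conv_rhs => rw [← hCα]
    gcongr
    · exact one_div_nonneg.2 hpα.nonneg
    refine le_trans (le_of_eq ?_) hC
    rw [lintegral_withDensity_eq_lintegral_mul _ hh
      (((hf.div hh).indicator hA).pow_const α), ← lintegral_indicator hA]
    refine lintegral_congr fun x => ?_
    by_cases hx : x ∈ A
    · simp [hx, mul_comm]
    · simp [hx, ENNReal.zero_rpow_of_pos hpα.pos]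
  · calc ∫⁻ x in Aᶜ, g x ∂γ.withDensity f ≤ ∫⁻ x in Aᶜ, 1 ∂γ.withDensity f := by
          gcongr with x; exact h1 x
      _ ≤ η := by simpa using hη

end RenyiClose

/-! ### Elementary exponential estimates -/

lemma exp_le_one_add_add_sq_mul_exp (t : ℝ) : Real.exp t ≤ 1 + t + t ^ 2 * Real.exp (max t 0) := by
  rcases le_total 0 t with h | h
  · rw [max_eq_left h]
    have h1 : Real.exp t - 1 ≤ t * Real.exp t := by
      have := Real.add_one_le_exp (-t)
      have h2 : Real.exp (-t) * Real.exp t = 1 := by rw [← Real.exp_add]; simp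
      nlinarith [Real.exp_pos t]
    nlinarith
  · rw [max_eq_right h, Real.exp_zero]
    have h1 : Real.exp t * (1 - t) ≤ 1 := by
      have := Real.add_one_le_exp (-t)
      have h2 : Real.exp t * Real.exp (-t) = 1 := by rw [← Real.exp_add]; simp
      nlinarith [Real.exp_pos t]
    by_contra! hlt
    have : (1 + t + t ^ 2 * 1) * (1 - t) < Real.exp t * (1 - t) :=
      mul_lt_mul_of_pos_right hlt (by linarith)
    nlinarith [mul_nonneg (sq_nonneg t) (neg_nonneg.2 h)]

lemma sq_le_exp_add_exp_neg (x : ℝ) : x ^ 2 ≤ Real.exp x + Real.exp (-x) := by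
  have h : ∀ y : ℝ, 0 ≤ y → y ^ 2 ≤ Real.exp y + Real.exp (-y) := fun y hy => by
    have h6 := Real.cosh_eq y
    have h7 := Real.cosh_two_mul (y / 2)
    have h8 := Real.cosh_sq (y / 2)
    have h9 := Real.self_le_sinh_iff.2 (show 0 ≤ y / 2 by linarith)
    rw [show 2 * (y / 2) = y by ring] at h7
    nlinarith
  rcases le_total 0 x with hx | hx
  · exact h x hx
  · have := h (-x) (by linarith)
    rw [neg_neg, neg_sq] at this
    linarith

/-- First-order expansion of `W (f / W) ^ α` at `W` for the densities `f = 1 - q + q F` and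
`W = 1 - q + q G`. The linear term has mean at most zero, and `q` enters the remainder squared:
this is the amplification of privacy by subsampling. -/
lemma mul_div_rpow_le {q F G α : ℝ} (hq0 : 0 ≤ q) (hq1 : q ≤ 1) (hF : 0 < F)
    (hW : 1 / 2 ≤ 1 - q + q * G) (hα : 0 ≤ α) :
    ((1 - q + q * F) / (1 - q + q * G)) ^ α * (1 - q + q * G) ≤
      1 - q + q * G + α * q * (F - G) +
        (2 * α * q) ^ 2 / 2 * ((F - G) ^ 2 * Real.exp (2 * α * q * max (F - G) 0)) := by
  set W := 1 - q + q * G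
  have hW0 : 0 < W := by linarith
  set Z := q * (F - G) / W
  have hZ : (1 - q + q * F) / W = 1 + Z := by
    simp only [Z]; field_simp; simp only [W]; ring
  have hZ0 : 0 ≤ 1 + Z := by
    rw [← hZ]
    have : 0 ≤ q * F := by positivity
    exact div_nonneg (by linarith) hW0.le
  have h1 : (1 + Z) ^ α ≤ Real.exp (α * Z) := by
    calc (1 + Z) ^ α ≤ Real.exp Z ^ α := by
          gcongr; linarith [Real.add_one_le_exp Z]
      _ = _ := by rw [← Real.exp_mul, mul_comm]
  have h2 := exp_le_one_add_add_sq_mul_exp (α * Z)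
  have hinv : 1 / W ≤ 2 := by
    rw [div_le_iff₀ hW0]; linarith
  have hZmax : max (α * Z) 0 ≤ 2 * α * q * max (F - G) 0 := by
    apply max_le
    · have : α * Z = (1 / W) * (α * q * (F - G)) := by simp only [Z]; ring
      rw [this]
      have h3 : α * q * (F - G) ≤ α * q * max (F - G) 0 := by gcongr; exact le_max_left _ _
      calc 1 / W * (α * q * (F - G)) ≤ 1 / W * (α * q * max (F - G) 0) := by gcongr
        _ ≤ 2 * (α * q * max (F - G) 0) := by
          apply mul_le_mul_of_nonneg_right hinv
          have := le_max_right (F - G) 0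
          positivity
        _ = _ := by ring
    · have := le_max_right (F - G) 0
      positivity
  rw [hZ]
  have hWZ : W * Z = q * (F - G) := by simp only [Z]; field_simp
  calc (1 + Z) ^ α * W ≤ (1 + α * Z + (α * Z) ^ 2 * Real.exp (max (α * Z) 0)) * W := by
        gcongr; exact h1.trans h2
    _ = W + α * (W * Z) + (α ^ 2 * (W * Z) ^ 2) * (1 / W) * Real.exp (max (α * Z) 0) := by
        field_simp
    _ ≤ W + α * (W * Z) + (α ^ 2 * (W * Z) ^ 2) * 2 *
          Real.exp (2 * α * q * max (F - G) 0) := by gcongr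
    _ = _ := by rw [hWZ]; ring

/-- On the event that `exp x ≤ exp ℓ` or `exp x ≤ exp y`, the second-order remainder is dominated by
a combination of exponentials of `x` and `y`. -/
lemma sq_mul_exp_le {x y β s ℓ : ℝ} (hβ : 0 ≤ β) (hs : 0 < s)
    (hℓ : 2 * β * Real.exp ℓ ≤ s ^ 2 / 32) (hA : x ≤ y ∨ x ≤ ℓ) :
    (Real.exp x - Real.exp y) ^ 2 * Real.exp (β * max (Real.exp x - Real.exp y) 0) ≤
      6 * (Real.exp x - 1) ^ 2 + 6 * (Real.exp y - 1) ^ 2 +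
      16 / s ^ 2 * (Real.exp ((4 * β + s) * x) + Real.exp ((4 * β - s) * x)) +
      4 * (Real.exp (-(3 / 32 * s ^ 2)) * Real.exp ((2 + s ^ 2 / 8) * x)) +
      4 / s ^ 2 * (Real.exp ((s - 2 * β) * y) + Real.exp ((-s - 2 * β) * y)) := by
  set F := Real.exp x with hF
  set G := Real.exp y with hG
  have hF0 : 0 < F := Real.exp_pos x
  have hG0 : 0 < G := Real.exp_pos y
  have p1 : 0 ≤ (F - 1) ^ 2 := by positivity
  have p2 : 0 ≤ (G - 1) ^ 2 := by positivity
  have p3 : 0 ≤ 16 / s ^ 2 * (Real.exp ((4 * β + s) * x) + Real.exp ((4 * β - s) * x)) := by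
    positivity
  have p4 : 0 ≤ 4 * (Real.exp (-(3 / 32 * s ^ 2)) * Real.exp ((2 + s ^ 2 / 8) * x)) := by
    positivity
  have p5 : 0 ≤ 4 / s ^ 2 * (Real.exp ((s - 2 * β) * y) + Real.exp ((-s - 2 * β) * y)) := by
    positivity
  rcases le_or_gt (F - G) 0 with hU | hU
  · rw [max_eq_right hU, mul_zero, Real.exp_zero, mul_one]
    nlinarith [sq_nonneg (F - 1 + (G - 1))]
  rw [max_eq_left hU.le]
  have hxℓ : x ≤ ℓ := by
    refine hA.resolve_left fun h => ?_
    have := Real.exp_le_exp.2 h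
    linarith
  -- The larger of `F - 1` and `1 - G` is at least half of `F - G`.
  rcases le_total (1 - G) (F - 1) with h | h
  · have hF1 : 0 < F - 1 := by linarith
    have hx0 : 0 < x := by
      rw [← Real.one_lt_exp_iff]; linarith
    have hstep : (F - G) ^ 2 * Real.exp (β * (F - G)) ≤
        (2 * (F - 1)) ^ 2 * Real.exp (β * (2 * (F - 1))) := by
      have : F - G ≤ 2 * (F - 1) := by linarith
      gcongr
    refine hstep.trans ?_
    rcases le_or_gt x 1 with hx1 | hx1
    · have hFx : F - 1 ≤ 2 * x := by
        have := Real.abs_exp_sub_one_le (x := x) (by rw [abs_of_pos hx0]; exact hx1)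
        rw [abs_of_pos hx0] at this
        exact (le_abs_self _).trans this
      have h3 : (s * x) ^ 2 ≤ Real.exp (s * x) + Real.exp (-(s * x)) := sq_le_exp_add_exp_neg _
      have h4 : (2 * (F - 1)) ^ 2 * Real.exp (β * (2 * (F - 1))) ≤
          (2 * (2 * x)) ^ 2 * Real.exp (β * (2 * (2 * x))) := by gcongr
      have h5 : (2 * (2 * x)) ^ 2 * Real.exp (β * (2 * (2 * x))) =
          16 / s ^ 2 * ((s * x) ^ 2 * Real.exp (4 * β * x)) := by
        rw [show β * (2 * (2 * x)) = 4 * β * x by ring]; field_simp; ring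
      have h6 : 16 / s ^ 2 * ((s * x) ^ 2 * Real.exp (4 * β * x)) ≤
          16 / s ^ 2 * ((Real.exp (s * x) + Real.exp (-(s * x))) * Real.exp (4 * β * x)) := by
        gcongr
      have h7 : (Real.exp (s * x) + Real.exp (-(s * x))) * Real.exp (4 * β * x) =
          Real.exp ((4 * β + s) * x) + Real.exp ((4 * β - s) * x) := by
        rw [add_mul, ← Real.exp_add, ← Real.exp_add]
        congr 2 <;> ring
      rw [h7] at h6
      linarith
    · -- Here `2 β F ≤ s² / 32`, while `exp (s² (x - 1) / 8) ≥ 1`.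
      have h3 : β * (2 * (F - 1)) ≤ s ^ 2 / 32 := by
        have : F ≤ Real.exp ℓ := Real.exp_le_exp.2 hxℓ
        nlinarith
      have h4 : (2 * (F - 1)) ^ 2 * Real.exp (β * (2 * (F - 1))) ≤
          4 * (F ^ 2 * Real.exp (s ^ 2 / 32)) := by
        calc (2 * (F - 1)) ^ 2 * Real.exp (β * (2 * (F - 1))) ≤
            (2 * F) ^ 2 * Real.exp (s ^ 2 / 32) := by gcongr; linarith
          _ = _ := by ring
      have h5 : F ^ 2 * Real.exp (s ^ 2 / 32) ≤
          Real.exp (-(3 / 32 * s ^ 2)) * Real.exp ((2 + s ^ 2 / 8) * x) := by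
        rw [hF, ← Real.exp_nat_mul, ← Real.exp_add, ← Real.exp_add, Real.exp_le_exp]
        push_cast
        nlinarith [sq_nonneg s]
      linarith
  · have hG1 : 0 < 1 - G := by linarith
    have hy0 : y < 0 := by
      rw [← Real.exp_lt_one_iff]; linarith
    have hGy : 1 - G ≤ -y := by linarith [Real.add_one_le_exp y]
    have h3 : (s * y) ^ 2 ≤ Real.exp (s * y) + Real.exp (-(s * y)) := sq_le_exp_add_exp_neg _
    have h4 : (F - G) ^ 2 * Real.exp (β * (F - G)) ≤
        (2 * (-y)) ^ 2 * Real.exp (β * (2 * (-y))) := by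
      have : F - G ≤ 2 * (-y) := by linarith
      gcongr
    have h5 : (2 * (-y)) ^ 2 * Real.exp (β * (2 * (-y))) =
        4 / s ^ 2 * ((s * y) ^ 2 * Real.exp (-(2 * β * y))) := by
      rw [show β * (2 * (-y)) = -(2 * β * y) by ring]; field_simp; ring
    have h6 : 4 / s ^ 2 * ((s * y) ^ 2 * Real.exp (-(2 * β * y))) ≤
        4 / s ^ 2 * ((Real.exp (s * y) + Real.exp (-(s * y))) * Real.exp (-(2 * β * y))) := by
      gcongr
    have h7 : (Real.exp (s * y) + Real.exp (-(s * y))) * Real.exp (-(2 * β * y)) =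
        Real.exp ((s - 2 * β) * y) + Real.exp ((-s - 2 * β) * y) := by
      rw [add_mul, ← Real.exp_add, ← Real.exp_add]
      congr 2 <;> ring
    rw [h7] at h6
    linarith

/-! ### Gaussian shifts -/

section Gaussian

variable {ι : Type*} [Fintype ι]

/-- The standard normal distribution on `ι → ℝ`. -/
noncomputable def stdGauss (ι : Type*) [Fintype ι] : Measure (ι → ℝ) :=
  Measure.pi fun _ => gaussianReal 0 1

instance : IsProbabilityMeasure (stdGauss ι) := by
  unfold stdGauss; infer_instance

/-- The logarithm of the density of `N(v, I)` with respect to `N(0, I)`. -/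
noncomputable def logShift (v ξ : ι → ℝ) : ℝ := ∑ i, (v i * ξ i - v i ^ 2 / 2)

@[fun_prop]
lemma measurable_logShift (v : ι → ℝ) : Measurable (logShift v) := by
  unfold logShift; fun_prop

lemma integrable_exp_mul_logShift (τ : ℝ) (v : ι → ℝ) :
    Integrable (fun ξ => Real.exp (τ * logShift v ξ)) (stdGauss ι) := by
  have e : (fun ξ : ι → ℝ => Real.exp (τ * logShift v ξ)) =
      fun ξ => ∏ i, (Real.exp (-(τ * v i ^ 2 / 2)) * Real.exp (τ * v i * ξ i)) := by
    funext ξ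
    simp_rw [logShift, Finset.mul_sum, Real.exp_sum, ← Real.exp_add]
    exact Finset.prod_congr rfl fun i _ => by congr 1; ring
  rw [e]
  exact Integrable.fintype_prod fun i => (integrable_exp_mul_gaussianReal _).const_mul _

lemma integral_exp_mul_logShift (τ : ℝ) (v : ι → ℝ) :
    ∫ ξ, Real.exp (τ * logShift v ξ) ∂stdGauss ι =
      Real.exp ((τ ^ 2 - τ) * (∑ i, v i ^ 2) / 2) := by
  have e : (fun ξ : ι → ℝ => Real.exp (τ * logShift v ξ)) =
      fun ξ => ∏ i, (Real.exp (-(τ * v i ^ 2 / 2)) * Real.exp (τ * v i * ξ i)) := by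
    funext ξ
    simp_rw [logShift, Finset.mul_sum, Real.exp_sum, ← Real.exp_add]
    exact Finset.prod_congr rfl fun i _ => by congr 1; ring
  rw [e, stdGauss, integral_fintype_prod_eq_prod (𝕜 := ℝ)
    (f := fun i x => Real.exp (-(τ * v i ^ 2 / 2)) * Real.exp (τ * v i * x)),
    Finset.mul_sum, Finset.sum_div, Real.exp_sum]
  refine Finset.prod_congr rfl fun i _ => ?_
  rw [integral_const_mul]
  have := congrFun (mgf_fun_id_gaussianReal (μ := 0) (v := 1)) (τ * v i)
  rw [mgf] at this
  rw [this, ← Real.exp_add]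
  congr 1
  simp; ring

lemma gaussianReal_one_eq_withDensity (a : ℝ) : gaussianReal a 1 =
    (gaussianReal 0 1).withDensity fun x => ENNReal.ofReal (Real.exp (a * x - a ^ 2 / 2)) := by
  rw [gaussianReal_of_var_ne_zero _ one_ne_zero, gaussianReal_of_var_ne_zero _ one_ne_zero,
    ← withDensity_mul _ (by fun_prop) (by fun_prop)]
  congr 1
  funext x
  simp only [gaussianPDF, Pi.mul_apply, gaussianPDFReal]
  rw [← ENNReal.ofReal_mul (by positivity), mul_assoc (√_)⁻¹, ← Real.exp_add]
  congr 3
  simp; ring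

/-- The Cameron-Martin formula. -/
lemma map_add_stdGauss (v : ι → ℝ) : (stdGauss ι).map (fun ξ i => v i + ξ i) =
    (stdGauss ι).withDensity fun ξ => ENNReal.ofReal (Real.exp (logShift v ξ)) := by
  unfold stdGauss
  rw [Measure.pi_map_pi (f := fun i x => v i + x) fun i => by fun_prop]
  simp_rw [gaussianReal_map_const_add, zero_add]
  refine Measure.pi_eq fun S hS => ?_
  rw [withDensity_apply _ (.univ_pi hS), ← lintegral_indicator (.univ_pi hS)]
  have e : ∀ ξ : ι → ℝ, (Set.univ.pi S).indicator
      (fun ξ => ENNReal.ofReal (Real.exp (logShift v ξ))) ξ = ∏ i, (S i).indicator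
        (fun x => ENNReal.ofReal (Real.exp (v i * x - v i ^ 2 / 2))) (ξ i) := fun ξ => by
    by_cases h : ∀ i, ξ i ∈ S i
    · rw [Set.indicator_of_mem (by simpa using h), logShift, Real.exp_sum,
        ENNReal.ofReal_prod_of_nonneg fun i _ => (Real.exp_pos _).le]
      exact Finset.prod_congr rfl fun i _ => by rw [Set.indicator_of_mem (h i)]
    · rw [Set.indicator_of_notMem (by simpa using h)]
      push Not at h
      obtain ⟨i, hi⟩ := h
      rw [Finset.prod_eq_zero (Finset.mem_univ i)]
      rw [Set.indicator_of_notMem hi]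
  have hm : ∀ i, Measurable ((S i).indicator
      fun x => ENNReal.ofReal (Real.exp (v i * x - v i ^ 2 / 2))) := fun i =>
    Measurable.indicator (by fun_prop) (hS i)
  simp_rw [e]
  rw [lintegral_prod_eq_prod_lintegral_of_indepFun Finset.univ
    (fun i (ξ : ι → ℝ) => (S i).indicator
        (fun x => ENNReal.ofReal (Real.exp (v i * x - v i ^ 2 / 2))) (ξ i))
    (iIndepFun_pi fun i => (hm i).aemeasurable) fun i => (hm i).comp (measurable_pi_apply i)]
  refine Finset.prod_congr rfl fun i _ => ?_
  rw [gaussianReal_one_eq_withDensity (v i), withDensity_apply _ (hS i),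
    ← lintegral_indicator (hS i)]
  have := (measurePreserving_eval (fun _ : ι => gaussianReal 0 1) i).lintegral_comp (hm i)
  simpa [Function.eval] using this

end Gaussian

/-! ### The subsampled Gaussian mechanism -/

section Subsampled

variable {ι : Type*} [Fintype ι]

/-- The law of the subsampled Gaussian mechanism in the coordinates centered at a third point: with
probability `q` the standard normal noise is shifted by `v`. -/
noncomputable def gaussMix (q : ℝ) (v : ι → ℝ) : Measure (ι → ℝ) :=
  (stdGauss ι).withDensity fun ξ => ENNReal.ofReal (1 - q + q * Real.exp (logShift v ξ))

lemma gaussMix_eq {q : ℝ} (hq0 : 0 ≤ q) (hq1 : q ≤ 1) (v : ι → ℝ) :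
    gaussMix q v = ENNReal.ofReal (1 - q) • stdGauss ι +
      ENNReal.ofReal q • (stdGauss ι).map (fun ξ i => v i + ξ i) := by
  have h1 : (fun ξ => ENNReal.ofReal (1 - q + q * Real.exp (logShift v ξ))) =
      (fun _ => ENNReal.ofReal (1 - q)) +
        ENNReal.ofReal q • fun ξ => ENNReal.ofReal (Real.exp (logShift v ξ)) := by
    funext ξ
    rw [Pi.add_apply, Pi.smul_apply, smul_eq_mul, ← ENNReal.ofReal_mul hq0,
      ENNReal.ofReal_add (by linarith) (by positivity)]
  rw [gaussMix, h1, withDensity_add_left measurable_const, withDensity_const,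
    withDensity_smul _ (by fun_prop), map_add_stdGauss]

lemma integrable_exp_logShift (v : ι → ℝ) :
    Integrable (fun ξ => Real.exp (logShift v ξ)) (stdGauss ι) := by
  simpa using integrable_exp_mul_logShift 1 v

lemma integral_exp_logShift (v : ι → ℝ) : ∫ ξ, Real.exp (logShift v ξ) ∂stdGauss ι = 1 := by
  simpa using integral_exp_mul_logShift 1 v

lemma integrable_exp_logShift_sub_one_sq (v : ι → ℝ) :
    Integrable (fun ξ => (Real.exp (logShift v ξ) - 1) ^ 2) (stdGauss ι) := by
  have : (fun ξ => (Real.exp (logShift v ξ) - 1) ^ 2) = fun ξ =>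
      Real.exp (2 * logShift v ξ) - 2 * Real.exp (logShift v ξ) + 1 := by
    funext ξ
    rw [two_mul (logShift v ξ), Real.exp_add]; ring
  rw [this]
  exact ((integrable_exp_mul_logShift 2 v).sub ((integrable_exp_logShift v).const_mul 2)).add
    (integrable_const 1)

variable {s : ℝ} {v : ι → ℝ}

/-- The lower bound `0.44` for `s²` comes from `le_two_mul_log`; it turns exponentials of `1 / s²`
into constants. -/
lemma integral_exp_logShift_sub_one_sq_le (hs : 0.44 ≤ s ^ 2)
    (hv : ∑ i, v i ^ 2 ≤ 4 / s ^ 2) :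
    ∫ ξ, (Real.exp (logShift v ξ) - 1) ^ 2 ∂stdGauss ι ≤ 4 * Real.exp 10 / s ^ 2 := by
  have : (fun ξ => (Real.exp (logShift v ξ) - 1) ^ 2) = fun ξ =>
      Real.exp (2 * logShift v ξ) - 2 * Real.exp (logShift v ξ) + 1 := by
    funext ξ
    rw [two_mul (logShift v ξ), Real.exp_add]; ring
  have hs0 : 0 < s ^ 2 := by linarith
  set x := ∑ i, v i ^ 2
  have hint : ∫ ξ, (Real.exp (2 * logShift v ξ) - 2 * Real.exp (logShift v ξ) + 1) ∂stdGauss ι =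
      Real.exp x - 1 := by
    have i1 := integrable_exp_mul_logShift 2 v
    have i2 := (integrable_exp_logShift v).const_mul 2
    have e1 := integral_add (i1.sub i2) (integrable_const (1 : ℝ))
    have e2 := integral_sub i1 i2
    simp only [Pi.sub_apply] at e1
    rw [e1, e2, integral_exp_mul_logShift, integral_const_mul, integral_exp_logShift]
    have e : ((2 : ℝ) ^ 2 - 2) * x / 2 = x := by ring
    rw [e]
    simp only [integral_const, probReal_univ, smul_eq_mul]
    ring
  rw [this, hint]
  have hx0 : 0 ≤ x := Finset.sum_nonneg fun i _ => sq_nonneg _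
  have hx : x ≤ 10 := hv.trans (by rw [div_le_iff₀ hs0]; linarith)
  have h1 : Real.exp x - 1 ≤ x * Real.exp x := by
    have h2 := Real.add_one_le_exp (-x)
    have h3 : Real.exp (-x) * Real.exp x = 1 := by rw [← Real.exp_add]; simp
    nlinarith [Real.exp_pos x]
  have h4 : x * Real.exp x ≤ 4 / s ^ 2 * Real.exp 10 := by gcongr
  exact h1.trans (h4.trans (le_of_eq (by ring)))

lemma inv_sq_le (hs : 0.44 ≤ s ^ 2) : 1 / s ^ 2 ≤ 2.3 := by
  rw [div_le_iff₀ (by linarith)]; linarith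

lemma integral_exp_mul_logShift_le (hs : 0.44 ≤ s ^ 2) (hv : ∑ i, v i ^ 2 ≤ 4 / s ^ 2)
    {τ β : ℝ} (hτ : τ ^ 2 ≤ 32 * β ^ 2 + 2 * s ^ 2) :
    ∫ ξ, Real.exp (τ * logShift v ξ) ∂stdGauss ι ≤
      Real.exp 9 * Real.exp (96 * (β ^ 2 / s ^ 2)) := by
  rw [integral_exp_mul_logShift, ← Real.exp_add, Real.exp_le_exp]
  have hs0 : 0 < s ^ 2 := by linarith
  have hx0 : 0 ≤ ∑ i, v i ^ 2 := Finset.sum_nonneg fun i _ => sq_nonneg _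
  calc (τ ^ 2 - τ) * (∑ i, v i ^ 2) / 2 ≤ ((3 * τ ^ 2 + 1) / 4) * (∑ i, v i ^ 2) := by
        nlinarith [mul_nonneg (sq_nonneg (τ + 1)) hx0]
    _ ≤ ((3 * (32 * β ^ 2 + 2 * s ^ 2) + 1) / 4) * (4 / s ^ 2) := by gcongr
    _ = 96 * (β ^ 2 / s ^ 2) + 6 * (s ^ 2 / s ^ 2) + 1 / s ^ 2 := by ring
    _ ≤ _ := by
      rw [div_self hs0.ne']
      linarith [inv_sq_le hs]

/-- The exponent is large enough to dominate the truncated tail, but the prefactor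
`exp (-3 s² / 32)` wins. -/
lemma exp_neg_mul_integral_exp_le (hs : 0.44 ≤ s ^ 2) (hv : ∑ i, v i ^ 2 ≤ 4 / s ^ 2) :
    Real.exp (-(3 / 32 * s ^ 2)) *
      ∫ ξ, Real.exp ((2 + s ^ 2 / 8) * logShift v ξ) ∂stdGauss ι ≤ 16 * Real.exp 20 / s ^ 2 := by
  have hs0 : 0 < s ^ 2 := by linarith
  have hx0 : 0 ≤ ∑ i, v i ^ 2 := Finset.sum_nonneg fun i _ => sq_nonneg _
  rw [integral_exp_mul_logShift, ← Real.exp_add]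
  have h1 : -(3 / 32 * s ^ 2) + ((2 + s ^ 2 / 8) ^ 2 - (2 + s ^ 2 / 8)) * (∑ i, v i ^ 2) / 2 ≤
      20 + -(s ^ 2 / 16) := by
    calc _ ≤ -(3 / 32 * s ^ 2) + (2 + s ^ 2 / 8) ^ 2 / 2 * (∑ i, v i ^ 2) := by
          nlinarith [mul_nonneg (show 0 ≤ 2 + s ^ 2 / 8 by positivity) hx0]
      _ ≤ -(3 / 32 * s ^ 2) + (2 + s ^ 2 / 8) ^ 2 / 2 * (4 / s ^ 2) := by gcongr
      _ = -(s ^ 2 / 16) + (8 * (1 / s ^ 2) + (s ^ 2 / s ^ 2)) + ((s ^ 2 / s ^ 2) - 1) * s ^ 2 / 32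
        := by ring
      _ ≤ _ := by
        rw [div_self hs0.ne']
        linarith [inv_sq_le hs]
  have h2 : Real.exp (-(s ^ 2 / 16)) ≤ 16 / s ^ 2 := by
    rw [Real.exp_neg, ← one_div, div_le_div_iff₀ (Real.exp_pos _) hs0]
    linarith [Real.add_one_le_exp (s ^ 2 / 16)]
  calc _ ≤ Real.exp (20 + -(s ^ 2 / 16)) := Real.exp_le_exp.2 h1
    _ = Real.exp 20 * Real.exp (-(s ^ 2 / 16)) := Real.exp_add _ _
    _ ≤ Real.exp 20 * (16 / s ^ 2) := by gcongr
    _ = _ := by ring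

lemma integral_add_le {Ω : Type*} [MeasurableSpace Ω] {μ : Measure Ω} {f g : Ω → ℝ} {a b : ℝ}
    (hf : Integrable f μ ∧ ∫ x, f x ∂μ ≤ a) (hg : Integrable g μ ∧ ∫ x, g x ∂μ ≤ b) :
    Integrable (fun x => f x + g x) μ ∧ ∫ x, (f x + g x) ∂μ ≤ a + b :=
  ⟨hf.1.add hg.1, by rw [integral_add hf.1 hg.1]; exact add_le_add hf.2 hg.2⟩

lemma integral_const_mul_le {Ω : Type*} [MeasurableSpace Ω] {μ : Measure Ω} {f : Ω → ℝ}
    {a c : ℝ} (hc : 0 ≤ c) (hf : Integrable f μ ∧ ∫ x, f x ∂μ ≤ a) :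
    Integrable (fun x => c * f x) μ ∧ ∫ x, c * f x ∂μ ≤ c * a :=
  ⟨hf.1.const_mul c, by rw [integral_const_mul]; exact mul_le_mul_of_nonneg_left hf.2 hc⟩

/-- The zeroth- and first-order terms integrate to `1`. -/
lemma integral_linear_part (q α : ℝ) (a b : ι → ℝ) :
    Integrable (fun ξ => 1 - q + q * Real.exp (logShift b ξ) +
      α * q * (Real.exp (logShift a ξ) - Real.exp (logShift b ξ))) (stdGauss ι) ∧
    ∫ ξ, (1 - q + q * Real.exp (logShift b ξ) +
      α * q * (Real.exp (logShift a ξ) - Real.exp (logShift b ξ))) ∂stdGauss ι ≤ 1 := by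
  have ha := integrable_exp_logShift a
  have hb := integrable_exp_logShift b
  have i1 := (integrable_const (μ := stdGauss ι) (1 - q)).add (hb.const_mul q)
  have i2 := (ha.sub hb).const_mul (α * q)
  refine ⟨i1.add i2, le_of_eq ?_⟩
  have e1 := integral_add i1 i2
  have e2 := integral_add (integrable_const (μ := stdGauss ι) (1 - q)) (hb.const_mul q)
  have e3 := integral_sub ha hb
  simp only [Pi.add_apply, Pi.sub_apply] at e1 e2 e3
  rw [e1, e2, integral_const_mul, integral_const_mul, e3, integral_exp_logShift,
    integral_exp_logShift]
  simp

lemma one_add_mul_mul_exp_le {A B y : ℝ} (hB : 0 ≤ B) (hy : 0 ≤ y) :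
    1 + A * y * Real.exp (B * y) ≤ Real.exp ((A + B) * y) := by
  have h1 : 1 ≤ Real.exp (B * y) := Real.one_le_exp (by positivity)
  calc 1 + A * y * Real.exp (B * y) ≤ (A * y + 1) * Real.exp (B * y) := by linarith
    _ ≤ Real.exp (A * y) * Real.exp (B * y) := by
      gcongr; exact Real.add_one_le_exp _
    _ = _ := by rw [← Real.exp_add]; ring_nf

lemma half_le_subsampled_density {q : ℝ} {b : ι → ℝ} (hq0 : 0 ≤ q) (hq : q ≤ 1 / 2 ∨ b = 0)
    (ξ : ι → ℝ) : 1 / 2 ≤ 1 - q + q * Real.exp (logShift b ξ) := by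
  rcases hq with h | h
  · have : 0 ≤ q * Real.exp (logShift b ξ) := by positivity
    linarith
  · subst h
    norm_num [logShift]

/-- To bound the divergence it suffices to bound the second-order remainder `S` of the likelihood
ratio on an event `A`, since the first-order term is nonnegative off `A`. -/
lemma renyiClose_gaussMix_of_remainder {q α p V : ℝ} {η : ℝ≥0∞} {a b : ι → ℝ}
    (hpα : α.HolderConjugate p) (hq0 : 0 ≤ q) (hq1 : q ≤ 1) (hq : q ≤ 1 / 2 ∨ b = 0)
    {A : Set (ι → ℝ)} (hA : MeasurableSet A)
    (hAc : ∀ ξ ∉ A, logShift b ξ ≤ logShift a ξ) {S : (ι → ℝ) → ℝ} (hS0 : ∀ ξ, 0 ≤ S ξ)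
    (hAS : ∀ ξ ∈ A, ((1 - q + q * Real.exp (logShift a ξ)) /
        (1 - q + q * Real.exp (logShift b ξ))) ^ α * (1 - q + q * Real.exp (logShift b ξ)) ≤
      1 - q + q * Real.exp (logShift b ξ) +
        α * q * (Real.exp (logShift a ξ) - Real.exp (logShift b ξ)) + S ξ)
    (hS : Integrable S (stdGauss ι) ∧ ∫ ξ, S ξ ∂stdGauss ι ≤ V) (hη : gaussMix q a Aᶜ ≤ η) :
    RenyiClose p (ENNReal.ofReal ((1 + V) ^ (1 / α))) η (gaussMix q a) (gaussMix q b) := by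
  have hW := half_le_subsampled_density hq0 hq
  have hα := hpα.pos
  have hV0 : 0 ≤ V := (integral_nonneg hS0).trans hS.2
  have hfr : ∀ ξ : ι → ℝ, 0 ≤ 1 - q + q * Real.exp (logShift a ξ) := fun ξ => by
    have : 0 ≤ q * Real.exp (logShift a ξ) := by positivity
    linarith
  refine RenyiClose.of_density hpα (by fun_prop) (by fun_prop) (fun ξ => ?_)
    (fun ξ => ENNReal.ofReal_ne_top) hA ?_ hη
  · rw [Ne, ENNReal.ofReal_eq_zero, not_le]
    linarith [hW ξ]
  · have hL := integral_add_le (integral_linear_part q α a b) hS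
    have hpos : ∀ ξ, 0 ≤ 1 - q + q * Real.exp (logShift b ξ) +
        α * q * (Real.exp (logShift a ξ) - Real.exp (logShift b ξ)) + S ξ := fun ξ => by
      by_cases hξ : ξ ∈ A
      · refine le_trans ?_ (hAS ξ hξ)
        have := hW ξ
        exact mul_nonneg (Real.rpow_nonneg (div_nonneg (hfr ξ) (by linarith)) _) (by linarith)
      · have h1 : 0 ≤ Real.exp (logShift a ξ) - Real.exp (logShift b ξ) :=
          sub_nonneg.2 (Real.exp_le_exp.2 (hAc ξ hξ))
        have := hW ξ
        have := hS0 ξ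
        have : 0 ≤ α * q * (Real.exp (logShift a ξ) - Real.exp (logShift b ξ)) := by positivity
        linarith
    rw [ENNReal.ofReal_rpow_of_nonneg (by positivity) hα.le, ← Real.rpow_mul (by positivity),
      one_div_mul_cancel hα.ne', Real.rpow_one]
    calc _ ≤ ∫⁻ ξ in A, ENNReal.ofReal (1 - q + q * Real.exp (logShift b ξ) +
        α * q * (Real.exp (logShift a ξ) - Real.exp (logShift b ξ)) + S ξ) ∂stdGauss ι := by
          refine setLIntegral_mono_ae' hA (.of_forall fun ξ hξ => ?_)
          have := hW ξ
          rw [← ENNReal.ofReal_div_of_pos (by linarith),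
            ENNReal.ofReal_rpow_of_nonneg (div_nonneg (hfr ξ) (by linarith)) hα.le,
            ← ENNReal.ofReal_mul (Real.rpow_nonneg (div_nonneg (hfr ξ) (by linarith)) _)]
          exact ENNReal.ofReal_le_ofReal (hAS ξ hξ)
      _ ≤ ∫⁻ ξ, ENNReal.ofReal (1 - q + q * Real.exp (logShift b ξ) +
        α * q * (Real.exp (logShift a ξ) - Real.exp (logShift b ξ)) + S ξ) ∂stdGauss ι :=
          setLIntegral_le_lintegral _ _
      _ = ENNReal.ofReal _ := (ofReal_integral_eq_lintegral_ofReal hL.1 (.of_forall hpos)).symm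
      _ ≤ _ := ENNReal.ofReal_le_ofReal hL.2

/-- The divergence of order `2` of the subsampled Gaussian mechanism is `O(q² / s²)`. -/
theorem renyiClose_gaussMix_two {q : ℝ} {a b : ι → ℝ} (hs : 0.44 ≤ s ^ 2)
    (ha : ∑ i, a i ^ 2 ≤ 4 / s ^ 2) (hb : ∑ i, b i ^ 2 ≤ 4 / s ^ 2)
    (hq0 : 0 ≤ q) (hq1 : q ≤ 1) (hq : q ≤ 1 / 2 ∨ b = 0) :
    RenyiClose 2 (ENNReal.ofReal (Real.exp (Real.exp 14 * (q ^ 2 / s ^ 2) / 2))) 0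
      (gaussMix q a) (gaussMix q b) := by
  have hS := integral_const_mul_le (show 0 ≤ 4 * q ^ 2 by positivity) (integral_add_le
    ⟨integrable_exp_logShift_sub_one_sq a, integral_exp_logShift_sub_one_sq_le hs ha⟩
    ⟨integrable_exp_logShift_sub_one_sq b, integral_exp_logShift_sub_one_sq_le hs hb⟩)
  refine (renyiClose_gaussMix_of_remainder (α := 2) Real.HolderConjugate.two_two hq0 hq1 hq
    (A := Set.univ) .univ (by simp) (fun ξ => by positivity) (fun ξ _ => ?_) hS
    (by simp)).mono ?_ le_rfl
  · have hW := half_le_subsampled_density hq0 hq ξ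
    set F := Real.exp (logShift a ξ)
    set G := Real.exp (logShift b ξ)
    set W := 1 - q + q * G with hWdef
    have hW0 : 0 < W := by linarith
    have e : ((1 - q + q * F) / W) ^ (2 : ℝ) * W =
        W + 2 * q * (F - G) + q ^ 2 * (F - G) ^ 2 * (1 / W) := by
      have : 1 - q + q * F = W + q * (F - G) := by rw [hWdef]; ring
      rw [this, Real.rpow_two]
      field_simp
      ring
    have h1 : 1 / W ≤ 2 := by rw [div_le_iff₀ hW0]; linarith
    have h2 : q ^ 2 * (F - G) ^ 2 * (1 / W) ≤ q ^ 2 * (F - G) ^ 2 * 2 := by gcongr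
    have h3 : q ^ 2 * (F - G) ^ 2 * 2 ≤ 4 * q ^ 2 * ((F - 1) ^ 2 + (G - 1) ^ 2) := by
      have : (F - G) ^ 2 ≤ 2 * ((F - 1) ^ 2 + (G - 1) ^ 2) := by
        nlinarith [sq_nonneg (F - 1 + (G - 1))]
      nlinarith [mul_le_mul_of_nonneg_left this (sq_nonneg q)]
    rw [e]
    linarith
  · apply ENNReal.ofReal_le_ofReal
    set w := q ^ 2 / s ^ 2
    have hw : 0 ≤ w := by positivity
    have h4 : (32 : ℝ) ≤ Real.exp 4 := by
      have := Real.exp_one_gt_d9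
      have e : Real.exp 4 = Real.exp 1 ^ 4 := by rw [← Real.exp_nat_mul]; norm_num
      rw [e]
      calc (32 : ℝ) ≤ 2.7 ^ 4 := by norm_num
        _ ≤ _ := by gcongr; linarith
    have h5 : 1 + 4 * q ^ 2 * (4 * Real.exp 10 / s ^ 2 + 4 * Real.exp 10 / s ^ 2) ≤
        Real.exp (Real.exp 14 * w) := by
      calc _ = 32 * Real.exp 10 * w + 1 := by simp only [w]; ring
        _ ≤ Real.exp 4 * Real.exp 10 * w + 1 := by gcongr
        _ = Real.exp 14 * w + 1 := by rw [← Real.exp_add]; norm_num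
        _ ≤ _ := Real.add_one_le_exp _
    calc _ ≤ Real.exp (Real.exp 14 * w) ^ (1 / 2 : ℝ) := by gcongr
      _ = _ := by rw [← Real.exp_mul]; ring_nf

/-- A Chernoff bound with exponent `5 s²`. For `ℓ = 20 + log N / 2` and `s² ≥ 0.44` it is small
compared with `1 / N`. -/
lemma gaussMix_logShift_gt_le {q ℓ : ℝ} {a : ι → ℝ} (hs : 0 < s ^ 2)
    (ha : ∑ i, a i ^ 2 ≤ 4 / s ^ 2) (hq0 : 0 ≤ q) (hq1 : q ≤ 1) :
    gaussMix q a {ξ | ℓ < logShift a ξ} ≤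
      ENNReal.ofReal (Real.exp (50 * s ^ 2 + 10 - 5 * s ^ 2 * ℓ)) := by
  have hm : MeasurableSet {ξ : ι → ℝ | ℓ < logShift a ξ} :=
    measurableSet_lt measurable_const (by fun_prop)
  set μ := 5 * s ^ 2 with hμ
  have hμ0 : 0 < μ := by positivity
  have hx0 : 0 ≤ ∑ i, a i ^ 2 := Finset.sum_nonneg fun i _ => sq_nonneg _
  have key : ∀ τ : ℝ, τ ^ 2 - τ ≤ μ ^ 2 + μ →
      ∫ ξ, Real.exp (τ * logShift a ξ) ∂stdGauss ι ≤ Real.exp (50 * s ^ 2 + 10) := fun τ hτ => by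
    rw [integral_exp_mul_logShift, Real.exp_le_exp]
    calc (τ ^ 2 - τ) * (∑ i, a i ^ 2) / 2 ≤ (μ ^ 2 + μ) * (4 / s ^ 2) / 2 := by
          have : 0 ≤ μ ^ 2 + μ := by positivity
          gcongr
      _ = (50 * s ^ 2 + 10) * (s ^ 2 / s ^ 2) := by rw [hμ]; ring
      _ = _ := by rw [div_self hs.ne', mul_one]
  have hI := integral_const_mul_le (Real.exp_pos (-(μ * ℓ))).le (integral_add_le
    (integral_const_mul_le (sub_nonneg.2 hq1) ⟨integrable_exp_mul_logShift μ a,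
      key μ (by nlinarith)⟩)
    (integral_const_mul_le hq0 ⟨integrable_exp_mul_logShift (μ + 1) a, key (μ + 1) (by nlinarith)⟩))
  rw [gaussMix, withDensity_apply _ hm]
  calc _ ≤ ∫⁻ ξ in {ξ | ℓ < logShift a ξ}, ENNReal.ofReal (Real.exp (-(μ * ℓ)) *
        ((1 - q) * Real.exp (μ * logShift a ξ) + q * Real.exp ((μ + 1) * logShift a ξ)))
        ∂stdGauss ι := by
        refine setLIntegral_mono_ae' hm (.of_forall fun ξ hξ => ENNReal.ofReal_le_ofReal ?_)
        have h1 : 1 ≤ Real.exp (-(μ * ℓ)) * Real.exp (μ * logShift a ξ) := by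
          rw [← Real.exp_add]
          apply Real.one_le_exp
          have := mul_le_mul_of_nonneg_left (le_of_lt hξ) hμ0.le
          linarith
        rw [add_mul μ, one_mul, Real.exp_add]
        have h2 : 0 ≤ 1 - q + q * Real.exp (logShift a ξ) := by
          have : 0 ≤ q * Real.exp (logShift a ξ) := by positivity
          linarith
        nlinarith [mul_le_mul_of_nonneg_right h1 h2]
    _ ≤ ∫⁻ ξ, ENNReal.ofReal (Real.exp (-(μ * ℓ)) *
        ((1 - q) * Real.exp (μ * logShift a ξ) + q * Real.exp ((μ + 1) * logShift a ξ)))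
        ∂stdGauss ι := setLIntegral_le_lintegral _ _
    _ = ENNReal.ofReal _ := (ofReal_integral_eq_lintegral_ofReal hI.1 (.of_forall fun ξ => by
        have : 0 ≤ 1 - q := by linarith
        positivity)).symm
    _ ≤ _ := by
      apply ENNReal.ofReal_le_ofReal
      refine hI.2.trans (le_of_eq ?_)
      rw [← add_mul, sub_add_cancel, one_mul, ← Real.exp_add]
      congr 1
      ring

/-- The divergence of a large order `α` of the subsampled Gaussian mechanism is `O(α² q² / s²)`,
once an event is discarded on which the likelihood ratio of a shift exceeds `exp ℓ`. -/
theorem renyiClose_gaussMix_large {q α p ℓ : ℝ} {a b : ι → ℝ} (hpα : α.HolderConjugate p)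
    (hs0 : 0 < s) (hs : 0.44 ≤ s ^ 2)
    (ha : ∑ i, a i ^ 2 ≤ 4 / s ^ 2) (hb : ∑ i, b i ^ 2 ≤ 4 / s ^ 2)
    (hq0 : 0 ≤ q) (hq1 : q ≤ 1) (hq : q ≤ 1 / 2 ∨ b = 0)
    (hℓ : 2 * (2 * α * q) * Real.exp ℓ ≤ s ^ 2 / 32) :
    RenyiClose p (ENNReal.ofReal (Real.exp (Real.exp 25 * ((2 * α * q) ^ 2 / s ^ 2) / α)))
      (ENNReal.ofReal (Real.exp (50 * s ^ 2 + 10 - 5 * s ^ 2 * ℓ)))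
      (gaussMix q a) (gaussMix q b) := by
  have hα := hpα.pos
  set β := 2 * α * q with hβ
  have hβ0 : 0 ≤ β := by positivity
  have hs2 : 0 < s ^ 2 := by positivity
  have key : ∀ {v : ι → ℝ}, ∑ i, v i ^ 2 ≤ 4 / s ^ 2 → ∀ τ : ℝ, τ ^ 2 ≤ 32 * β ^ 2 + 2 * s ^ 2 →
      Integrable (fun ξ => Real.exp (τ * logShift v ξ)) (stdGauss ι) ∧
      ∫ ξ, Real.exp (τ * logShift v ξ) ∂stdGauss ι ≤
        Real.exp 9 * Real.exp (96 * (β ^ 2 / s ^ 2)) := fun hv τ hτ =>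
    ⟨integrable_exp_mul_logShift _ _, integral_exp_mul_logShift_le hs hv hτ⟩
  have hS := integral_const_mul_le (show 0 ≤ β ^ 2 / 2 by positivity) <|
    integral_add_le (integral_add_le (integral_add_le (integral_add_le
      (integral_const_mul_le (show (0 : ℝ) ≤ 6 by norm_num)
        ⟨integrable_exp_logShift_sub_one_sq a, integral_exp_logShift_sub_one_sq_le hs ha⟩)
      (integral_const_mul_le (show (0 : ℝ) ≤ 6 by norm_num)
        ⟨integrable_exp_logShift_sub_one_sq b, integral_exp_logShift_sub_one_sq_le hs hb⟩))
      (integral_const_mul_le (show 0 ≤ 16 / s ^ 2 by positivity)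
        (integral_add_le (key ha (4 * β + s) (by nlinarith [sq_nonneg (4 * β - s)]))
          (key ha (4 * β - s) (by nlinarith [sq_nonneg (4 * β + s)])))))
      (integral_const_mul_le (show (0 : ℝ) ≤ 4 by norm_num)
        ⟨(integrable_exp_mul_logShift (2 + s ^ 2 / 8) a).const_mul (Real.exp (-(3 / 32 * s ^ 2))),
          (integral_const_mul _ _).trans_le (exp_neg_mul_integral_exp_le hs ha)⟩))
      (integral_const_mul_le (show 0 ≤ 4 / s ^ 2 by positivity)
        (integral_add_le (key hb (s - 2 * β) (by nlinarith [sq_nonneg (2 * β + s), sq_nonneg β]))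
          (key hb (-s - 2 * β) (by nlinarith [sq_nonneg (2 * β - s), sq_nonneg β]))))
  refine (renyiClose_gaussMix_of_remainder hpα hq0 hq1 hq
    (A := {ξ | logShift a ξ ≤ logShift b ξ ∨ logShift a ξ ≤ ℓ}) ?_ ?_ (fun ξ => by positivity)
    (fun ξ hξ => ?_) hS ((measure_mono ?_).trans
      (gaussMix_logShift_gt_le hs2 ha hq0 hq1))).mono ?_ le_rfl
  · exact (measurableSet_le (measurable_logShift a) (measurable_logShift b)).union
      (measurableSet_le (measurable_logShift a) measurable_const)
  · intro ξ hξ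
    simp only [Set.mem_ofPred_eq, not_or, not_le] at hξ
    exact hξ.1.le
  · refine (mul_div_rpow_le hq0 hq1 (Real.exp_pos _) (half_le_subsampled_density hq0 hq ξ)
      hα.le).trans ?_
    rw [← hβ]
    gcongr
    exact sq_mul_exp_le hβ0 hs0 hℓ hξ
  · intro ξ hξ
    simp only [Set.mem_compl_iff, Set.mem_ofPred_eq, not_or, not_le] at hξ
    exact hξ.2
  · apply ENNReal.ofReal_le_ofReal
    set w := β ^ 2 / s ^ 2 with hw_def
    set E := Real.exp (96 * w)
    have hw : 0 ≤ w := by positivity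
    have hE : 1 ≤ E := Real.one_le_exp (by positivity)
    have e5 : (100 : ℝ) ≤ Real.exp 5 := by
      have := Real.exp_one_gt_d9
      have e : Real.exp 5 = Real.exp 1 ^ 5 := by rw [← Real.exp_nat_mul]; norm_num
      rw [e]
      calc (100 : ℝ) ≤ 2.7 ^ 5 := by norm_num
        _ ≤ _ := by gcongr; linarith
    have e10 : Real.exp 10 = Real.exp 5 * Real.exp 5 := by rw [← Real.exp_add]; norm_num
    have e20 : Real.exp 20 = Real.exp 10 * Real.exp 10 := by rw [← Real.exp_add]; norm_num
    have e25 : Real.exp 25 = Real.exp 5 * Real.exp 20 := by rw [← Real.exp_add]; norm_num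
    have h9 : Real.exp 9 ≤ Real.exp 10 := Real.exp_le_exp.2 (by norm_num)
    have h10 : (10000 : ℝ) ≤ Real.exp 10 := by rw [e10]; nlinarith
    have h20 : 10000 * Real.exp 10 ≤ Real.exp 20 := by rw [e20]; gcongr
    have h25 : 100 * Real.exp 20 ≤ Real.exp 25 := by rw [e25]; gcongr
    have h5 : 1 + β ^ 2 / 2 * (6 * (4 * Real.exp 10 / s ^ 2) + 6 * (4 * Real.exp 10 / s ^ 2) +
        16 / s ^ 2 * (Real.exp 9 * E + Real.exp 9 * E) + 4 * (16 * Real.exp 20 / s ^ 2) +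
        4 / s ^ 2 * (Real.exp 9 * E + Real.exp 9 * E)) ≤ Real.exp (Real.exp 25 * w) := by
      calc _ = 1 + (24 * Real.exp 10 + 20 * Real.exp 9 * E + 32 * Real.exp 20) * w := by
            simp only [hw_def]; ring
        _ ≤ 1 + (50 * Real.exp 20) * w * E := by
          have : 24 * Real.exp 10 + 20 * Real.exp 9 * E + 32 * Real.exp 20 ≤
              50 * Real.exp 20 * E := by
            nlinarith [Real.exp_pos 20]
          nlinarith [mul_le_mul_of_nonneg_right this hw]
        _ ≤ Real.exp ((50 * Real.exp 20 + 96) * w) := one_add_mul_mul_exp_le (by norm_num) hw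
        _ ≤ _ := by
          rw [Real.exp_le_exp]
          gcongr
          linarith
    calc _ ≤ Real.exp (Real.exp 25 * w) ^ (1 / α : ℝ) := by gcongr
      _ = _ := by rw [← Real.exp_mul]; ring_nf

end Subsampled

/-! ### Parametrized laws -/

section Laws

variable {X Y Z : Type*} [MeasurableSpace X] [MeasurableSpace Y] [MeasurableSpace Z]

lemma measurable_map_uncurry (μ : Measure Y) [SFinite μ] {f : X → Y → Z}
    (hf : Measurable (Function.uncurry f)) : Measurable fun x => μ.map (f x) := by
  refine Measure.measurable_of_measurable_coe _ fun S hS => ?_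
  have : (fun x => μ.map (f x) S) = fun x => μ (Prod.mk x ⁻¹' (Function.uncurry f ⁻¹' S)) := by
    funext x
    have hfx : Measurable (f x) := hf.comp measurable_prodMk_left
    rw [Measure.map_apply hfx hS]
    rfl
  rw [this]
  exact measurable_measure_prodMk_left (hf hS)

lemma map_prod_eq_bind (μ : Measure X) (ν : Measure Y) [SFinite ν] {f : X × Y → Z}
    (hf : Measurable f) : (μ.prod ν).map f = μ.bind fun x => ν.map fun y => f (x, y) := by
  ext S hS
  rw [Measure.map_apply hf hS, Measure.prod_apply (hf hS),
    Measure.bind_apply hS (measurable_map_uncurry (f := fun x y => f (x, y)) ν hf).aemeasurable]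
  refine lintegral_congr fun x => ?_
  rw [Measure.map_apply (by fun_prop) hS]
  rfl

lemma lintegral_uniformOn {n : ℕ} (s : Finset (Fin n)) (f : Fin n → ℝ≥0∞) :
    ∫⁻ j, f j ∂uniformOn (s : Set (Fin n)) = (s.card : ℝ≥0∞)⁻¹ * ∑ j ∈ s, f j := by
  rw [uniformOn, ProbabilityTheory.cond, lintegral_smul_measure, lintegral_finset]
  simp

end Laws

/-! ### Averages of shifted Gaussians -/

section Average

variable {ι : Type*}

lemma measurable_add_of_fst {n : ℕ} (u : Fin n → ι → ℝ) :
    Measurable fun (ω : Fin n × (ι → ℝ)) i => u ω.1 i + ω.2 i :=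
  measurable_from_prod_countable_right fun J => by fun_prop

variable [Fintype ι]

/-- The law of `u J + ξ` for a uniform index `J` and standard normal noise `ξ`. -/
noncomputable def averageLaw {n : ℕ} (u : Fin n → ι → ℝ) : Measure (ι → ℝ) :=
  ((uniformOn (Set.univ : Set (Fin n))).prod (stdGauss ι)).map fun ω i => u ω.1 i + ω.2 i

lemma averageLaw_apply {n : ℕ} (u : Fin n → ι → ℝ) {S : Set (ι → ℝ)} (hS : MeasurableSet S) :
    averageLaw u S =
      (n : ℝ≥0∞)⁻¹ * ∑ J, (stdGauss ι).map (fun ξ i => u J i + ξ i) S := by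
  rw [averageLaw, map_prod_eq_bind _ _ (measurable_add_of_fst u),
    Measure.bind_apply hS (measurable_of_countable _).aemeasurable, ← Finset.coe_univ,
    lintegral_uniformOn, Finset.card_univ, Fintype.card_fin]

lemma map_add_gaussMix {q : ℝ} (hq0 : 0 ≤ q) (hq1 : q ≤ 1) (r v : ι → ℝ) :
    (gaussMix q fun i => v i - r i).map (fun ξ i => r i + ξ i) =
      ENNReal.ofReal (1 - q) • (stdGauss ι).map (fun ξ i => r i + ξ i) +
        ENNReal.ofReal q • (stdGauss ι).map (fun ξ i => v i + ξ i) := by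
  rw [gaussMix_eq hq0 hq1, Measure.map_add _ _ (by fun_prop), Measure.map_smul, Measure.map_smul,
    Measure.map_map (by fun_prop) (by fun_prop)]
  congr 4
  funext ξ i
  simp only [Function.comp_apply]
  ring

instance isProbabilityMeasure_averageLaw {n : ℕ} [NeZero n] (u : Fin n → ι → ℝ) :
    IsProbabilityMeasure (averageLaw u) := by
  have : IsProbabilityMeasure (uniformOn (Set.univ : Set (Fin n))) :=
    isProbabilityMeasure_uniformOn Set.finite_univ Set.univ_nonempty
  exact Measure.isProbabilityMeasure_map (measurable_add_of_fst u).aemeasurable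

/-- An average over `n ≥ 2` indices is a mixture, over the indices `J ≠ j₀`, of two-point mixtures
in which `j₀` has the weight `1 / n`. The center `r j₀` does not matter. -/
lemma averageLaw_eq_bind {n : ℕ} (hn : 2 ≤ n) {u r : Fin n → ι → ℝ} {j₀ : Fin n}
    (h : ∀ J, J ≠ j₀ → u J = r J) :
    averageLaw u = (uniformOn (({j₀}ᶜ : Finset (Fin n)) : Set (Fin n))).bind fun J =>
      (gaussMix (1 / n) fun i => u j₀ i - r J i).map fun ξ i => r J i + ξ i := by
  have hn0 : (0 : ℝ) < n := by positivity
  have hq1 : 1 / (n : ℝ) ≤ 1 := by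
    rw [div_le_one hn0]; exact_mod_cast (by omega : 1 ≤ n)
  ext S hS
  rw [averageLaw_apply u hS, Measure.bind_apply hS (measurable_of_countable _).aemeasurable,
    lintegral_uniformOn]
  simp_rw [map_add_gaussMix (by positivity : 0 ≤ 1 / (n : ℝ)) hq1]
  simp only [Measure.coe_add, Pi.add_apply, Measure.smul_apply, smul_eq_mul]
  rw [Finset.sum_add_distrib, ← Finset.mul_sum, Finset.sum_const, nsmul_eq_mul, mul_add,
    ← mul_assoc, ← mul_assoc _ (Finset.card _ : ℝ≥0∞), Finset.card_compl, Finset.card_singleton,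
    Fintype.card_fin, ← Finset.sum_add_sum_compl {j₀}, Finset.sum_singleton, mul_add, add_comm]
  have hc : ((n - 1 : ℕ) : ℝ≥0∞) ≠ 0 := by
    rw [Nat.cast_ne_zero]; omega
  have hinv : ENNReal.ofReal (1 / (n : ℝ)) = (n : ℝ≥0∞)⁻¹ := by
    rw [one_div, ENNReal.ofReal_inv_of_pos hn0, ENNReal.ofReal_natCast]
  have h1 : ENNReal.ofReal (1 - 1 / (n : ℝ)) = ((n - 1 : ℕ) : ℝ≥0∞) * (n : ℝ≥0∞)⁻¹ := by
    rw [← hinv, ← ENNReal.ofReal_natCast, ← ENNReal.ofReal_mul (by positivity)]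
    congr 1
    rw [Nat.cast_sub (by omega)]
    field_simp
    simp
  rw [h1, ← mul_assoc, ENNReal.inv_mul_cancel hc (ENNReal.natCast_ne_top _), one_mul, one_mul, hinv]
  congr 2
  exact Finset.sum_congr rfl fun J hJ => by rw [h J (by simpa using hJ)]

lemma sum_sub_sq_le {s : ℝ} {u v : ι → ℝ} (hu : ∑ i, u i ^ 2 ≤ 1 / s ^ 2)
    (hv : ∑ i, v i ^ 2 ≤ 1 / s ^ 2) : ∑ i, (u i - v i) ^ 2 ≤ 4 / s ^ 2 := by
  calc ∑ i, (u i - v i) ^ 2 ≤ ∑ i, (2 * u i ^ 2 + 2 * v i ^ 2) :=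
        Finset.sum_le_sum fun i _ => by nlinarith [sq_nonneg (u i + v i)]
    _ = 2 * ∑ i, u i ^ 2 + 2 * ∑ i, v i ^ 2 := by
        rw [Finset.sum_add_distrib, Finset.mul_sum, Finset.mul_sum]
    _ ≤ 2 * (1 / s ^ 2) + 2 * (1 / s ^ 2) := by gcongr
    _ = _ := by ring

/-- A divergence bound for the subsampled Gaussian mechanism with rate `1 / n` passes to averages
over `n` centers that differ in one center. -/
lemma renyiClose_averageLaw {n : ℕ} [NeZero n] {p s : ℝ} {C η : ℝ≥0∞} (hp : 1 ≤ p)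
    (H : ∀ a b : ι → ℝ, ∑ i, a i ^ 2 ≤ 4 / s ^ 2 → ∑ i, b i ^ 2 ≤ 4 / s ^ 2 →
      (1 / (n : ℝ) ≤ 1 / 2 ∨ b = 0) →
      RenyiClose p C η (gaussMix (1 / n) a) (gaussMix (1 / n) b))
    {u u' : Fin n → ι → ℝ} {j₀ : Fin n} (h : ∀ J, J ≠ j₀ → u J = u' J)
    (hu : ∀ J, ∑ i, u J i ^ 2 ≤ 1 / s ^ 2) (hu' : ∀ J, ∑ i, u' J i ^ 2 ≤ 1 / s ^ 2) :
    RenyiClose p C η (averageLaw u) (averageLaw u') := by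
  have hn1 : 1 ≤ n := NeZero.one_le
  rcases hn1.eq_or_lt with hn | hn
  · -- A single center: the reference point is the center of the second law.
    subst hn
    have e : ∀ w : Fin 1 → ι → ℝ, averageLaw w =
        (gaussMix (1 / (1 : ℕ)) fun i => w j₀ i - u' j₀ i).map fun ξ i => u' j₀ i + ξ i :=
        fun w => by
      rw [map_add_gaussMix (by norm_num) (by norm_num)]
      ext S hS
      rw [averageLaw_apply w hS]
      simp [Subsingleton.elim j₀ 0]
    rw [e u, e u']
    refine (H _ _ (sum_sub_sq_le (hu _) (hu' _)) (sum_sub_sq_le (hu' _) (hu' _)) (.inr ?_)).map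
      (by fun_prop)
    funext i
    simp
  · have hn2 : (2 : ℝ) ≤ n := by exact_mod_cast hn
    rw [averageLaw_eq_bind hn (fun _ _ => rfl : ∀ J, J ≠ j₀ → u J = u J),
      averageLaw_eq_bind hn fun J hJ => (h J hJ).symm]
    have hprob : ∀ J, IsProbabilityMeasure
        ((gaussMix (1 / n) fun i => u j₀ i - u J i).map fun ξ i => u J i + ξ i) := fun J => by
      refine ⟨?_⟩
      rw [map_add_gaussMix (by positivity) (by rw [div_le_one] <;> linarith)]
      have h1 : ∀ v : ι → ℝ, IsProbabilityMeasure ((stdGauss ι).map fun ξ i => v i + ξ i) :=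
        fun v => Measure.isProbabilityMeasure_map
          (by fun_prop : Measurable fun (ξ : ι → ℝ) i => v i + ξ i).aemeasurable
      have := h1 (u J)
      have := h1 (u j₀)
      simp only [Measure.coe_add, Pi.add_apply, Measure.smul_apply, smul_eq_mul, measure_univ,
        mul_one]
      rw [← ENNReal.ofReal_add _ (by positivity)]
      · simp
      · rw [sub_nonneg, div_le_one] <;> linarith
    have : IsProbabilityMeasure (uniformOn (({j₀}ᶜ : Finset (Fin n)) : Set (Fin n))) := by
      refine isProbabilityMeasure_uniformOn (Set.toFinite _) ?_
      rw [Finset.coe_nonempty, ← Finset.card_pos, Finset.card_compl, Finset.card_singleton,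
        Fintype.card_fin]
      omega
    refine RenyiClose.mixture hp _ (measurable_of_countable _) (measurable_of_countable _) hprob
      fun J => ?_
    refine (H _ _ (sum_sub_sq_le (hu _) (hu _)) (sum_sub_sq_le (hu' _) (hu _)) (.inl ?_)).map
      (by fun_prop)
    gcongr

end Average

/-! ### Weight clustering -/

section Clustering

lemma measurable_of_countable_cases {X Y O : Type*} [MeasurableSpace X] [MeasurableSpace Y]
    [Countable O] {g : X → O} (hg : ∀ o, MeasurableSet {x | g x = o}) {H : O → X → Y}
    (hH : ∀ o, Measurable (H o)) : Measurable fun x => H (g x) x := fun S hS => by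
  have : (fun x => H (g x) x) ⁻¹' S = ⋃ o, {x | g x = o} ∩ H o ⁻¹' S := by
    ext x; simp
  rw [this]
  exact .iUnion fun o => (hg o).inter (hH o hS)

lemma measurableSet_argmin_eq {X β : Type*} [MeasurableSpace X] [Countable β] {f : X → β → ℝ≥0∞}
    (hf : ∀ b, Measurable fun x => f x b) (l : List β) (o : Option β) :
    MeasurableSet {x | l.argmin (f x) = o} := by
  induction l using List.reverseRecOn generalizing o with
  | nil => simp
  | append_singleton l a ih =>
    classical
    have : {x | (l ++ [a]).argmin (f x) = o} = ⋃ o' : Option β, {x | l.argmin (f x) = o'} ∩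
        {x | Option.rec (some a) (fun c => if f x a < f x c then some a else some c) o' = o} := by
      ext x
      simp [List.argmin_concat]
    rw [this]
    refine .iUnion fun o' => (ih o').inter ?_
    cases o' with
    | none => exact MeasurableSet.const (some a = o)
    | some c =>
      have e : {x | (if f x a < f x c then some a else some c) = o} =
          ({x | f x a < f x c} ∩ {_x | some a = o}) ∪
            ({x | f x a < f x c}ᶜ ∩ {_x | some c = o}) := by
        ext x
        by_cases hx : f x a < f x c <;> simp [hx]
      have hm := measurableSet_lt (hf a) (hf c)
      exact e ▸ (hm.inter (.const _)).union (hm.compl.inter (.const _))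

variable {P : ℕ}

lemma measurable_mergeStep : Measurable (mergeStep (P := P)) := by
  refine measurable_from_prod_countable_right fun lab => ?_
  refine measurable_of_countable_cases
    (g := fun c => (groupPairs lab).argmin (dissimilarity c))
    (H := fun o c => match o with
      | none => (lab, c)
      | some p => (fun i => if lab i = p.2 then p.1 else lab i,
          Function.update c p.1 (√(c p.1 ^ 2 + c p.2 ^ 2))))
    (fun o => measurableSet_argmin_eq (fun p => by unfold dissimilarity; fun_prop) _ o)
    fun o => ?_
  cases o with
  | none => exact measurable_const.prodMk measurable_id
  | some p =>
    refine measurable_const.prodMk (measurable_pi_iff.2 fun i => ?_)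
    by_cases hi : i = p.1
    · subst hi
      simp only [Function.update_self]
      fun_prop
    · simp only [Function.update_of_ne hi]
      fun_prop

lemma measurable_weightClustering (k : ℕ) :
    Measurable (weightClustering (P := P) k) :=
  (measurable_mergeStep.iterate _).comp (measurable_const.prodMk measurable_id)

/-- The representatives of the groups. -/
def groupReps (𝒢 : Grouping P) : Finset (Fin P) := {j | 𝒢.1 j = j}

/-- Labels are representatives, and clipping bounds are nonnegative. -/
def IsGrouping (𝒢 : Grouping P) : Prop := (∀ i, 𝒢.1 (𝒢.1 i) = 𝒢.1 i) ∧ ∀ i, 0 ≤ 𝒢.2 i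

lemma mem_groupPairs {lab : Fin P → Fin P} {p : Fin P × Fin P} :
    p ∈ groupPairs lab ↔ p.1 < p.2 ∧ lab p.1 = p.1 ∧ lab p.2 = p.2 := by
  have : p ∈ (List.finRange P).product (List.finRange P) :=
    List.mem_product.2 ⟨List.mem_finRange _, List.mem_finRange _⟩
  simp [groupPairs, this]

lemma isGrouping_mergeStep {𝒢 : Grouping P} (h : IsGrouping 𝒢) : IsGrouping (mergeStep 𝒢) := by
  unfold mergeStep
  split
  · exact h
  · next p hp =>
    obtain ⟨hlt, h1, h2⟩ := mem_groupPairs.1 (List.argmin_mem hp)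
    refine ⟨fun i => ?_, fun i => ?_⟩
    · by_cases hi : 𝒢.1 i = p.2
      · simp [hi, h1, hlt.ne]
      · simp [hi, h.1 i]
    · by_cases hi : i = p.1
      · subst hi; simp
      · simpa [Function.update_of_ne hi] using h.2 i

/-- A merger lowers the number of groups, unless there is just one. -/
lemma card_groupReps_mergeStep {𝒢 : Grouping P} {N : ℕ} (h : (groupReps 𝒢).card ≤ max 1 (N + 1)) :
    (groupReps (mergeStep 𝒢)).card ≤ max 1 N := by
  unfold mergeStep
  split
  · next hp =>
    rw [List.argmin_eq_none] at hp
    refine le_trans ?_ (le_max_left _ _)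
    rw [Finset.card_le_one]
    intro a ha b hb
    simp only [groupReps, Finset.mem_filter, Finset.mem_univ, true_and] at ha hb
    by_contra hab
    rcases lt_or_gt_of_ne hab with hab | hab
    · have : (a, b) ∈ groupPairs 𝒢.1 := mem_groupPairs.2 ⟨hab, ha, hb⟩
      simp [hp] at this
    · have : (b, a) ∈ groupPairs 𝒢.1 := mem_groupPairs.2 ⟨hab, hb, ha⟩
      simp [hp] at this
  · next p hp =>
    obtain ⟨hlt, h1, h2⟩ := mem_groupPairs.1 (List.argmin_mem hp)
    have hsub : groupReps (fun i => if 𝒢.1 i = p.2 then p.1 else 𝒢.1 i,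
        Function.update 𝒢.2 p.1 (√(𝒢.2 p.1 ^ 2 + 𝒢.2 p.2 ^ 2))) ⊆ (groupReps 𝒢).erase p.2 := by
      intro j hj
      simp only [groupReps, Finset.mem_filter, Finset.mem_univ, true_and, Finset.mem_erase] at hj ⊢
      by_cases hjp : 𝒢.1 j = p.2
      · rw [if_pos hjp] at hj
        rw [← hj, h1] at hjp
        exact absurd hjp hlt.ne
      · rw [if_neg hjp] at hj
        exact ⟨fun e => hjp (by rw [e, h2]), hj⟩
    have hmem : p.2 ∈ groupReps 𝒢 := by simp [groupReps, h2]
    have := Finset.card_le_card hsub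
    rw [Finset.card_erase_of_mem hmem] at this
    omega

lemma isGrouping_weightClustering (k : ℕ) {c : Fin P → ℝ} (hc : ∀ i, 0 ≤ c i) :
    IsGrouping (weightClustering k c) :=
  Function.Iterate.rec IsGrouping ⟨fun _ => rfl, hc⟩ (fun _ h => isGrouping_mergeStep h) (P - k)

lemma card_groupReps_weightClustering {k : ℕ} (hk : 0 < k) (c : Fin P → ℝ) :
    (groupReps (weightClustering k c)).card ≤ k := by
  have h : ∀ j ≤ P, (groupReps (mergeStep^[j] (id, c))).card ≤ max 1 (P - j) := by
    intro j
    induction j with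
    | zero => intro _; simp [groupReps]
    | succ j ih =>
      intro hj
      rw [Function.iterate_succ_apply']
      exact card_groupReps_mergeStep (by
        have := ih (by omega)
        rwa [show P - (j + 1) + 1 = P - j by omega])
  rcases le_total k P with hkP | hkP
  · exact (h (P - k) (by omega)).trans (by omega)
  · calc (groupReps (weightClustering k c)).card ≤ (Finset.univ : Finset (Fin P)).card :=
        Finset.card_le_univ _
      _ ≤ k := by simpa using hkP

lemma paramBounds_nonneg {b : ℕ} (g : Fin b → Vec P) (i : Fin P) : 0 ≤ paramBounds g i := by
  unfold paramBounds; positivity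

/-! ### Sensitivity of the clipped gradient -/

/-- The clipped gradient in units of the standard deviation of the noise. -/
noncomputable def scaledClip (σ : ℝ) (𝒢 : Grouping P) (g : Vec P) (i : Fin P) : ℝ :=
  groupClip 𝒢 g i / (σ * 𝒢.2 (𝒢.1 i))

lemma groupClipPerturb_eq {σ : ℝ} (hσ : σ ≠ 0) (𝒢 : Grouping P) (g : Vec P) (ξ : Fin P → ℝ) :
    groupClipPerturb σ 𝒢 g ξ =
      WithLp.toLp 2 fun i => σ * 𝒢.2 (𝒢.1 i) * (scaledClip σ 𝒢 g i + ξ i) := by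
  unfold groupClipPerturb scaledClip
  congr 1
  funext i
  by_cases h : 𝒢.2 (𝒢.1 i) = 0
  · simp [groupClip, h]
  · field_simp

lemma sum_sq_scaledClip_group_le {σ : ℝ} (hσ : 0 < σ) {𝒢 : Grouping P} (h : IsGrouping 𝒢)
    (g : Vec P) (j : Fin P) : ∑ i with 𝒢.1 i = j, scaledClip σ 𝒢 g i ^ 2 ≤ 1 / σ ^ 2 := by
  by_cases hj : 𝒢.2 j = 0
  · rw [Finset.sum_eq_zero]
    · positivity
    · intro i hi
      simp only [Finset.mem_filter, Finset.mem_univ, true_and] at hi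
      simp [scaledClip, hi, hj]
  have hc : 0 < 𝒢.2 j := lt_of_le_of_ne (h.2 j) (Ne.symm hj)
  set N := groupNorm 𝒢 g j
  set M := max 1 (N / 𝒢.2 j)
  have hM : 0 < M := lt_of_lt_of_le one_pos (le_max_left _ _)
  have hN : N ^ 2 = ∑ i with 𝒢.1 i = j, g i ^ 2 :=
    Real.sq_sqrt (Finset.sum_nonneg fun i _ => sq_nonneg _)
  have hN0 : 0 ≤ N := Real.sqrt_nonneg _
  have e : ∑ i with 𝒢.1 i = j, scaledClip σ 𝒢 g i ^ 2 = (N / 𝒢.2 j / M) ^ 2 * (1 / σ ^ 2) := by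
    rw [div_pow, div_pow, hN, Finset.sum_div, Finset.sum_div, Finset.sum_mul]
    refine Finset.sum_congr rfl fun i hi => ?_
    simp only [Finset.mem_filter, Finset.mem_univ, true_and] at hi
    simp only [scaledClip, groupClip, hi, if_neg hj]
    change (g i / M / (σ * 𝒢.2 j)) ^ 2 = _
    field_simp
  rw [e]
  have h1 : N / 𝒢.2 j / M ≤ 1 := by
    rw [div_le_one hM]; exact le_max_right _ _
  have h2 : (N / 𝒢.2 j / M) ^ 2 ≤ 1 := pow_le_one₀ (by positivity) h1
  exact mul_le_of_le_one_left (by positivity) h2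

/-- Each of the at most `k` groups contributes at most `1 / σ²`. -/
lemma sum_sq_scaledClip_le {σ : ℝ} (hσ : 0 < σ) {𝒢 : Grouping P} (h : IsGrouping 𝒢) {k : ℕ}
    (hk : (groupReps 𝒢).card ≤ k) (g : Vec P) : ∑ i, scaledClip σ 𝒢 g i ^ 2 ≤ k / σ ^ 2 := by
  rw [← Finset.sum_fiberwise_of_maps_to (s := Finset.univ) (t := groupReps 𝒢) (g := 𝒢.1)
    (fun i _ => by simpa [groupReps] using h.1 i)]
  calc _ ≤ ∑ _j ∈ groupReps 𝒢, 1 / σ ^ 2 :=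
        Finset.sum_le_sum fun j _ => sum_sq_scaledClip_group_le hσ h g j
    _ = (groupReps 𝒢).card * (1 / σ ^ 2) := by rw [Finset.sum_const, nsmul_eq_mul]
    _ ≤ k * (1 / σ ^ 2) := by gcongr
    _ = _ := by ring

/-! ### Measurability of clipping and of Adam -/

lemma measurable_eval_fst {X : Type*} [MeasurableSpace X] {lab : X → Fin P → Fin P}
    {c : X → Fin P → ℝ} (hl : Measurable lab) (hc : Measurable c) (i : Fin P) :
    Measurable fun x => c x (lab x i) :=
  measurable_of_countable_cases (g := lab) (H := fun l x => c x (l i))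
    (fun l => hl (measurableSet_singleton l)) fun l => by fun_prop

lemma measurable_groupNorm (i : Fin P) :
    Measurable fun p : Grouping P × Vec P => groupNorm p.1 p.2 (p.1.1 i) :=
  measurable_of_countable_cases (g := fun p : Grouping P × Vec P => p.1.1)
    (H := fun l p => √(∑ i' with l i' = l i, p.2 i' ^ 2))
    (fun l => (measurable_fst.comp measurable_fst) (measurableSet_singleton l))
    fun l => by fun_prop

lemma measurable_groupClip : Measurable fun p : Grouping P × Vec P => groupClip p.1 p.2 := by
  have hc : ∀ i, Measurable fun p : Grouping P × Vec P => p.1.2 (p.1.1 i) := fun i =>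
    measurable_eval_fst (by fun_prop) (by fun_prop) i
  unfold groupClip
  refine (WithLp.measurable_toLp _ _).comp (measurable_pi_iff.2 fun i => ?_)
  refine Measurable.ite (hc i (measurableSet_singleton 0)) measurable_const ?_
  have := measurable_groupNorm i
  have := hc i
  fun_prop

lemma measurable_scaledClip (σ : ℝ) :
    Measurable fun p : Grouping P × Vec P => scaledClip σ p.1 p.2 := by
  refine measurable_pi_iff.2 fun i => ?_
  have h1 : Measurable fun p : Grouping P × Vec P => p.1.2 (p.1.1 i) :=
    measurable_eval_fst (by fun_prop) (by fun_prop) i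
  have h2 : Measurable fun p : Grouping P × Vec P => groupClip p.1 p.2 i := by
    exact (EuclideanSpace.proj i).continuous.measurable.comp measurable_groupClip
  exact h2.div (h1.const_mul σ)

lemma measurable_adamStep (a : AdamParams) :
    Measurable fun p : Vec P × (Vec P × AdamState P) => adamStep a p.1 p.2 := by
  unfold adamStep
  have h : ∀ b : ℝ, Measurable fun p : Vec P × (Vec P × AdamState P) =>
      b ^ (p.2.2.2.2 + 1) := fun b =>
    (measurable_of_countable fun j : ℕ => b ^ (j + 1)).comp (by fun_prop)
  have h1 := h a.β₁
  have h2 := h a.β₂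
  refine Measurable.prodMk ?_ (Measurable.prodMk ?_ (Measurable.prodMk ?_ ?_)) <;> fun_prop

lemma _root_.Measurable.adamStep {X : Type*} [MeasurableSpace X] (a : AdamParams) {f : X → Vec P}
    {g : X → Vec P × AdamState P} (hf : Measurable f) (hg : Measurable g) :
    Measurable fun x => adamStep a (f x) (g x) :=
  (measurable_adamStep a).comp (hf.prodMk hg)

end Clustering

/-! ### Measurability of the algorithm -/

section Algorithm

lemma measurable_map_of_measurable {X Y Z : Type*} [MeasurableSpace X] [MeasurableSpace Y]
    [MeasurableSpace Z] {κ : X → Measure Y} (hκ : Measurable κ)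
    (hprob : ∀ x, IsProbabilityMeasure (κ x)) {f : X → Y → Z}
    (hf : Measurable (Function.uncurry f)) : Measurable fun x => (κ x).map (f x) := by
  refine Measure.measurable_of_measurable_coe _ fun S hS => ?_
  have : (fun x => (κ x).map (f x) S) =
      fun x => κ x (Prod.mk x ⁻¹' (Function.uncurry f ⁻¹' S)) := by
    funext x
    have hfx : Measurable (f x) := hf.comp measurable_prodMk_left
    rw [Measure.map_apply hfx hS]
    rfl
  rw [this]
  have : IsMarkovKernel (⟨κ, hκ⟩ : Kernel X Y) := ⟨hprob⟩
  exact Kernel.measurable_kernel_prodMk_left (κ := ⟨κ, hκ⟩) (hf hS)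

lemma isProbabilityMeasure_uniform {N : ℕ} (hN : 0 < N) :
    IsProbabilityMeasure (uniformOn (Set.univ : Set (Fin N))) :=
  have : NeZero N := ⟨hN.ne'⟩
  isProbabilityMeasure_uniformOn Set.finite_univ Set.univ_nonempty

instance : IsProbabilityMeasure ((volume : Measure ℝ).restrict (Set.Icc 0 1)) :=
  ⟨by simp⟩

lemma isProbabilityMeasure_batchLaw {N : ℕ} (hN : 0 < N) (b : ℕ) {dZ : ℕ} (pz : Measure (Vec dZ))
    [IsProbabilityMeasure pz] : IsProbabilityMeasure (batchLaw N b pz) := by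
  have := isProbabilityMeasure_uniform hN
  unfold batchLaw
  infer_instance

instance isProbabilityMeasure_noiseLaw (b P : ℕ) : IsProbabilityMeasure (noiseLaw b P) := by
  unfold noiseLaw; infer_instance

variable {dX dW dΘ dZ : ℕ} {A : Config dX dW dΘ dZ}

lemma measurable_batchGrads (hA : A.Regular) {N b : ℕ} (data : Fin N → Vec dX) (i : Fin b) :
    Measurable fun p : (Vec dW × Vec dΘ) × BatchSeed N b dZ =>
      A.batchGrads data p.1.1 p.1.2 p.2 i := by
  unfold Config.batchGrads
  have hx : Measurable data := measurable_of_countable _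
  exact hA.measurable_wganGrad.comp (f := fun p : (Vec dW × Vec dΘ) × BatchSeed N b dZ =>
    (p.1.1, p.1.2, data (p.2 i).1, (p.2 i).2.1, (p.2 i).2.2)) (by fun_prop)

lemma measurable_grouping (hA : A.Regular) {nPub : ℕ} (pub : Fin nPub → Vec dX) :
    Measurable fun p : (Vec dW × Vec dΘ) × BatchSeed nPub A.mPub dZ =>
      A.grouping pub p.1.1 p.1.2 p.2 := by
  unfold Config.grouping paramBounds
  refine (measurable_weightClustering A.k).comp (measurable_pi_iff.2 fun i => ?_)
  have h := fun l => measurable_batchGrads hA (b := A.mPub) pub l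
  refine Measurable.div_const (Finset.measurable_sum _ fun l _ => ?_) _
  exact ((EuclideanSpace.proj i).continuous.measurable.comp (h l)).abs

/-- The update of the discriminator in terms of the noisy clipped gradients, each in units of the
standard deviation of its noise. -/
noncomputable def Config.criticUpdate (A : Config dX dW dΘ dZ) (s : NetState dW dΘ)
    (𝒢 : Grouping dW) (y : Fin A.m → Fin dW → ℝ) : NetState dW dΘ :=
  (adamStep A.adam ((1 / (A.m : ℝ)) • ∑ i,
    (WithLp.toLp 2 fun j => A.σ * 𝒢.2 (𝒢.1 j) * y i j : Vec dW)) s.1, s.2)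

lemma _root_.Measurable.criticUpdate {X : Type*} [MeasurableSpace X] {f : X → NetState dW dΘ}
    {g : X → Grouping dW} {h : X → Fin A.m → Fin dW → ℝ} (hf : Measurable f) (hg : Measurable g)
    (hh : Measurable h) : Measurable fun x => A.criticUpdate (f x) (g x) (h x) := by
  unfold Config.criticUpdate
  refine Measurable.prodMk (Measurable.adamStep A.adam (Measurable.fun_const_smul
    (Finset.measurable_fun_sum _ fun i _ => ?_) _) (by fun_prop))
      (by fun_prop)
  refine (WithLp.measurable_toLp _ _).comp (measurable_pi_iff.2 fun j => ?_)
  have : Measurable fun x => (g x).2 ((g x).1 j) :=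
    measurable_eval_fst (by fun_prop) (by fun_prop) j
  fun_prop

/-- The scaled clipped gradient of one member of the private batch. -/
noncomputable def Config.memberClip (A : Config dX dW dΘ dZ) (s : NetState dW dΘ) (𝒢 : Grouping dW)
    (x : Vec dX) (z : Vec dZ × ℝ) : Fin dW → ℝ :=
  scaledClip A.σ 𝒢 (A.wganGrad s.1.1 s.2.1 x z.1 z.2)

lemma measurable_memberClip (hA : A.Regular) {N : ℕ} (data : Fin N → Vec dX) :
    Measurable fun p : (NetState dW dΘ × Grouping dW) × (Fin N × Vec dZ × ℝ) =>
      A.memberClip p.1.1 p.1.2 (data p.2.1) p.2.2 := by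
  unfold Config.memberClip
  have hx : Measurable data := measurable_of_countable _
  exact (measurable_scaledClip A.σ).comp (Measurable.prodMk (by fun_prop)
    (hA.measurable_wganGrad.comp (f := fun p : (NetState dW dΘ × Grouping dW) ×
      (Fin N × Vec dZ × ℝ) => (p.1.1.1.1, p.1.1.2.1, data p.2.1, p.2.2.1, p.2.2.2)) (by fun_prop)))

/-- A group with bound `0` contributes `0` to both sides, by division by zero in `scaledClip`. -/
lemma criticStep_eq (hσ : A.σ ≠ 0) {nPub n : ℕ} (pub : Fin nPub → Vec dX) (data : Fin n → Vec dX)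
    (s : NetState dW dΘ)
    (ω : BatchSeed nPub A.mPub dZ × BatchSeed n A.m dZ × (Fin A.m → Fin dW → ℝ)) :
    A.criticStep pub data s ω = A.criticUpdate s (A.grouping pub s.1.1 s.2.1 ω.1) fun i j =>
      A.memberClip s (A.grouping pub s.1.1 s.2.1 ω.1) (data (ω.2.1 i).1) (ω.2.1 i).2 j +
        ω.2.2 i j := by
  unfold Config.criticStep Config.criticUpdate
  simp_rw [groupClipPerturb_eq hσ]
  rfl

lemma measurable_criticStep (hA : A.Regular) (hσ : A.σ ≠ 0) {nPub n : ℕ}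
    (pub : Fin nPub → Vec dX) (data : Fin n → Vec dX) :
    Measurable fun p : NetState dW dΘ ×
      (BatchSeed nPub A.mPub dZ × BatchSeed n A.m dZ × (Fin A.m → Fin dW → ℝ)) =>
      A.criticStep pub data p.1 p.2 := by
  simp_rw [criticStep_eq hσ]
  have hg : Measurable fun p : NetState dW dΘ ×
      (BatchSeed nPub A.mPub dZ × BatchSeed n A.m dZ × (Fin A.m → Fin dW → ℝ)) =>
      A.grouping pub p.1.1.1 p.1.2.1 p.2.1 :=
    (measurable_grouping hA pub).comp (f := fun p : NetState dW dΘ ×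
      (BatchSeed nPub A.mPub dZ × BatchSeed n A.m dZ × (Fin A.m → Fin dW → ℝ)) =>
      ((p.1.1.1, p.1.2.1), p.2.1)) (by fun_prop)
  have hy : Measurable fun (p : NetState dW dΘ ×
      (BatchSeed nPub A.mPub dZ × BatchSeed n A.m dZ × (Fin A.m → Fin dW → ℝ))) i j =>
      A.memberClip p.1 (A.grouping pub p.1.1.1 p.1.2.1 p.2.1) (data (p.2.2.1 i).1) (p.2.2.1 i).2 j +
        p.2.2.2 i j := ?_
  · exact Measurable.criticUpdate measurable_fst hg hy
  refine measurable_pi_iff.2 fun i => ?_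
  have hm := (measurable_memberClip hA data).comp (f := fun p : NetState dW dΘ ×
      (BatchSeed nPub A.mPub dZ × BatchSeed n A.m dZ × (Fin A.m → Fin dW → ℝ)) =>
      ((p.1, A.grouping pub p.1.1.1 p.1.2.1 p.2.1), p.2.2.1 i)) (by fun_prop)
  simp only [Function.comp_def] at hm
  fun_prop

lemma measurable_plainCriticStep (hA : A.Regular) {N : ℕ} (data : Fin N → Vec dX) :
    Measurable fun p : NetState dW dΘ × BatchSeed N A.m dZ =>
      A.plainCriticStep data p.1 p.2 := by
  unfold Config.plainCriticStep
  refine Measurable.prodMk (Measurable.adamStep A.adam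
    (Measurable.fun_const_smul (Finset.measurable_fun_sum _ fun i _ => ?_) _) (by fun_prop))
      (by fun_prop)
  exact (measurable_batchGrads hA data i).comp (f := fun p : NetState dW dΘ ×
    BatchSeed N A.m dZ => ((p.1.1.1, p.1.2.1), p.2)) (by fun_prop)

lemma measurable_genLaw (hA : A.Regular) : Measurable A.genLaw := by
  have := hA.latent_prob
  unfold Config.genLaw
  refine measurable_map_uncurry _ ?_
  refine Measurable.prodMk (by fun_prop) (Measurable.adamStep A.adam ?_ (by fun_prop))
  exact hA.measurable_genGrad.comp (f := fun p : NetState dW dΘ × (Fin A.m → Vec dZ) =>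
    (p.1.1.1, p.1.2.1, p.2)) (by fun_prop)

lemma isProbabilityMeasure_genLaw (hA : A.Regular) (s : NetState dW dΘ) :
    IsProbabilityMeasure (A.genLaw s) := by
  have := hA.latent_prob
  refine Measure.isProbabilityMeasure_map (Measurable.aemeasurable ?_)
  refine Measurable.prodMk (by fun_prop) (Measurable.adamStep A.adam ?_ (by fun_prop))
  exact hA.measurable_genGrad.comp (f := fun z : Fin A.m → Vec dZ =>
    (s.1.1, s.2.1, z)) (by fun_prop)

variable {nPub n : ℕ}

lemma measurable_criticLaw (hA : A.Regular) (hσ : A.σ ≠ 0) (hn : 0 < n) (hPub : 0 < nPub)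
    (pub : Fin nPub → Vec dX) (data : Fin n → Vec dX) : Measurable (A.criticLaw pub data) := by
  have := hA.latent_prob
  have := isProbabilityMeasure_batchLaw hn A.m A.latent
  have := isProbabilityMeasure_batchLaw hPub A.mPub A.latent
  exact measurable_map_uncurry _ (measurable_criticStep hA hσ pub data)

lemma isProbabilityMeasure_criticLaw (hA : A.Regular) (hσ : A.σ ≠ 0) (hn : 0 < n)
    (hPub : 0 < nPub) (pub : Fin nPub → Vec dX) (data : Fin n → Vec dX) (s : NetState dW dΘ) :
    IsProbabilityMeasure (A.criticLaw pub data s) := by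
  have := hA.latent_prob
  have := isProbabilityMeasure_batchLaw hn A.m A.latent
  have := isProbabilityMeasure_batchLaw hPub A.mPub A.latent
  exact Measure.isProbabilityMeasure_map
    ((measurable_criticStep hA hσ pub data).comp measurable_prodMk_left).aemeasurable

lemma isProbabilityMeasure_warmStart (hA : A.Regular) (hPub : 0 < nPub)
    (pub : Fin nPub → Vec dX) : IsProbabilityMeasure (A.warmStart pub) := by
  have := hA.latent_prob
  have := hA.init_prob
  have := isProbabilityMeasure_batchLaw hPub A.m A.latent
  have hκ : Measurable fun s' => (batchLaw nPub A.m A.latent).map (A.plainCriticStep pub s') :=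
    measurable_map_uncurry _ (measurable_plainCriticStep hA pub)
  have hκp : ∀ s', IsProbabilityMeasure
      ((batchLaw nPub A.m A.latent).map (A.plainCriticStep pub s')) := fun s' =>
    Measure.isProbabilityMeasure_map
      ((measurable_plainCriticStep hA pub).comp measurable_prodMk_left).aemeasurable
  have hit := measurable_iterateLaw hκ A.nCritic
  have hitp := isProbabilityMeasure_iterateLaw hκ hκp A.nCritic
  have hround := (Measure.measurable_bind' (measurable_genLaw hA)).comp hit
  have hroundp := fun s => have := hitp s
    isProbabilityMeasure_bind (P := iterateLaw (fun s' => (batchLaw nPub A.m A.latent).map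
      (A.plainCriticStep pub s')) A.nCritic s) (measurable_genLaw hA)
      (isProbabilityMeasure_genLaw hA)
  have hall : Measurable fun p : Vec dW × Vec dΘ =>
      (((p.1, adamInit dW), (p.2, adamInit dΘ)) : NetState dW dΘ) := by fun_prop
  have hP := isProbabilityMeasure_bind (P := A.init)
    ((measurable_iterateLaw hround A.tWarm).comp hall)
    fun p => isProbabilityMeasure_iterateLaw hround hroundp A.tWarm _
  exact @Measure.isProbabilityMeasure_map _ _ _ _ _ hP _ (by fun_prop)

/-- The law of the networks after one iteration of the main loop that is not skipped. -/
noncomputable def Config.roundLaw (A : Config dX dW dΘ dZ) (pub : Fin nPub → Vec dX)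
    (data : Fin n → Vec dX) (s : NetState dW dΘ) : Measure (NetState dW dΘ) :=
  (iterateLaw (A.criticLaw pub data) A.nCritic s).bind A.genLaw

lemma measurable_roundLaw (hA : A.Regular) (hσ : A.σ ≠ 0) (hn : 0 < n) (hPub : 0 < nPub)
    (pub : Fin nPub → Vec dX) (data : Fin n → Vec dX) : Measurable (A.roundLaw pub data) :=
  (Measure.measurable_bind' (measurable_genLaw hA)).comp
    (measurable_iterateLaw (measurable_criticLaw hA hσ hn hPub pub data) A.nCritic)

lemma isProbabilityMeasure_roundLaw (hA : A.Regular) (hσ : A.σ ≠ 0) (hn : 0 < n)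
    (hPub : 0 < nPub) (pub : Fin nPub → Vec dX) (data : Fin n → Vec dX) (s : NetState dW dΘ) :
    IsProbabilityMeasure (A.roundLaw pub data s) :=
  have := isProbabilityMeasure_iterateLaw (measurable_criticLaw hA hσ hn hPub pub data)
    (isProbabilityMeasure_criticLaw hA hσ hn hPub pub data) A.nCritic s
  isProbabilityMeasure_bind (measurable_genLaw hA) (isProbabilityMeasure_genLaw hA)

open Classical in
/-- The bookkeeping at the end of an iteration of the main loop. -/
noncomputable def Config.closeRound (A : Config dX dW dΘ dZ) (s : LoopState dW dΘ)
    (s' : NetState dW dΘ) : LoopState dW dΘ :=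
  (s', s.2.1 + A.nCritic, decide ((s.1, s') ∈ A.converged ∨
    A.δ₀ ≤ A.accountant A.σ A.m A.k (s.2.1 + A.nCritic) A.ε₀))

lemma measurable_closeRound (hA : A.Regular) :
    Measurable (Function.uncurry A.closeRound) := by
  unfold Config.closeRound
  refine Measurable.prodMk (by fun_prop) (Measurable.prodMk ?_ (measurable_to_bool ?_))
  · exact (measurable_of_countable fun j : ℕ => j + A.nCritic).comp
      (f := fun p : LoopState dW dΘ × NetState dW dΘ => p.1.2.1) (by fun_prop)
  · have h1 : MeasurableSet {p : LoopState dW dΘ × NetState dW dΘ | (p.1.1, p.2) ∈ A.converged} :=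
      (by fun_prop : Measurable fun p : LoopState dW dΘ × NetState dW dΘ => (p.1.1, p.2))
        hA.measurable_converged
    have h2 : MeasurableSet {p : LoopState dW dΘ × NetState dW dΘ |
        A.δ₀ ≤ A.accountant A.σ A.m A.k (p.1.2.1 + A.nCritic) A.ε₀} :=
      (by fun_prop : Measurable fun p : LoopState dW dΘ × NetState dW dΘ => p.1.2.1)
        (MeasurableSet.of_discrete
          (s := {j : ℕ | A.δ₀ ≤ A.accountant A.σ A.m A.k (j + A.nCritic) A.ε₀}))
    convert h1.union h2 using 1
    ext p
    simp

lemma loopLaw_eq (pub : Fin nPub → Vec dX) (data : Fin n → Vec dX) (s : LoopState dW dΘ) :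
    A.loopLaw pub data s = if s.2.2 then Measure.dirac s
      else (A.roundLaw pub data s.1).map (A.closeRound s) := rfl

lemma measurable_loopLaw (hA : A.Regular) (hσ : A.σ ≠ 0) (hn : 0 < n) (hPub : 0 < nPub)
    (pub : Fin nPub → Vec dX) (data : Fin n → Vec dX) : Measurable (A.loopLaw pub data) := by
  refine Measurable.ite ?_ Measure.measurable_dirac
    (measurable_map_of_measurable ((measurable_roundLaw hA hσ hn hPub pub data).comp measurable_fst)
      (fun s => isProbabilityMeasure_roundLaw hA hσ hn hPub pub data s.1)
      (measurable_closeRound hA))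
  exact (by fun_prop : Measurable fun s : LoopState dW dΘ => s.2.2) (measurableSet_singleton true)

lemma isProbabilityMeasure_loopLaw (hA : A.Regular) (hσ : A.σ ≠ 0) (hn : 0 < n)
    (hPub : 0 < nPub) (pub : Fin nPub → Vec dX) (data : Fin n → Vec dX) (s : LoopState dW dΘ) :
    IsProbabilityMeasure (A.loopLaw pub data s) := by
  rw [loopLaw_eq]
  split
  · infer_instance
  · have := isProbabilityMeasure_roundLaw hA hσ hn hPub pub data s.1
    exact Measure.isProbabilityMeasure_map
      ((measurable_closeRound hA).comp measurable_prodMk_left).aemeasurable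

lemma measurable_loopStart : Measurable fun p : Vec dW × Vec dΘ =>
    ((((p.1, adamInit dW), (p.2, adamInit dΘ)), 0, false) : LoopState dW dΘ) := by
  fun_prop

lemma isProbabilityMeasure_advancedDPGAN (hA : A.Regular) (hσ : A.σ ≠ 0) (hn : 0 < n)
    (hPub : 0 < nPub) (pub : Fin nPub → Vec dX) (t : ℕ) (data : Fin n → Vec dX) :
    IsProbabilityMeasure (A.advancedDPGAN pub t data) := by
  have hL := measurable_loopLaw hA hσ hn hPub pub data
  have := isProbabilityMeasure_warmStart hA hPub pub
  have hP := isProbabilityMeasure_bind (P := A.warmStart pub)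
    ((measurable_iterateLaw hL t).comp measurable_loopStart)
    fun p => isProbabilityMeasure_iterateLaw hL
      (isProbabilityMeasure_loopLaw hA hσ hn hPub pub data) t _
  exact @Measure.isProbabilityMeasure_map _ _ _ _ _ hP _ (by fun_prop)

/-! ### Privacy of the algorithm -/

lemma measurable_averageLaw {ι Z : Type*} [Fintype ι] [MeasurableSpace Z] {u : Fin n → Z → ι → ℝ}
    (hu : ∀ J, Measurable (u J)) : Measurable fun z => averageLaw fun J => u J z := by
  have hu' : Measurable fun p : Fin n × Z => u p.1 p.2 :=
    measurable_from_prod_countable_right hu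
  have hf : Measurable fun (ω : (Fin n × Z) × (ι → ℝ)) i => u ω.1.1 ω.1.2 i + ω.2 i := by
    fun_prop
  refine measurable_map_uncurry _ ?_
  exact hf.comp (f := fun p : Z × (Fin n × (ι → ℝ)) => ((p.2.1, p.1), p.2.2)) (by fun_prop)

lemma map_member_eq_bind {ι Z : Type*} [Fintype ι] [MeasurableSpace Z] (ν : Measure Z)
    [SFinite ν] [NeZero n] {u : Fin n → Z → ι → ℝ}
    (hu : ∀ J, Measurable (u J)) :
    (((uniformOn (Set.univ : Set (Fin n))).prod ν).prod (stdGauss ι)).map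
      (fun ω i => u ω.1.1 ω.1.2 i + ω.2 i) = ν.bind fun z => averageLaw fun J => u J z := by
  have := isProbabilityMeasure_uniform (NeZero.pos n)
  have hu' : Measurable fun p : Fin n × Z => u p.1 p.2 :=
    measurable_from_prod_countable_right hu
  have hf : Measurable fun (ω : (Fin n × Z) × (ι → ℝ)) i => u ω.1.1 ω.1.2 i + ω.2 i := by
    fun_prop
  have hm := measurable_averageLaw hu
  refine Measure.ext_of_lintegral _ fun g hg => ?_
  rw [lintegral_map hg hf, lintegral_prod _ (by fun_prop),
    lintegral_prod_symm _ (Measurable.aemeasurable ?_),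
    Measure.lintegral_bind hm.aemeasurable hg.aemeasurable]
  · refine lintegral_congr fun z => ?_
    rw [averageLaw, lintegral_map hg (measurable_add_of_fst fun J => u J z), lintegral_prod]
    exact (hg.comp (measurable_add_of_fst fun J => u J z)).aemeasurable
  · exact Measurable.lintegral_prod_right' (hg.comp hf)

lemma map_prod_pi_eq {Y S O : Type*} [MeasurableSpace S] [MeasurableSpace O] [MeasurableSpace Y]
    (μ : Measure S) (ν : Measure O) [IsProbabilityMeasure μ] [IsProbabilityMeasure ν] (b : ℕ)
    {f : S × O → Y} (hf : Measurable f) :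
    ((Measure.pi fun _ : Fin b => μ).prod (Measure.pi fun _ => ν)).map
      (fun ω i => f (ω.1 i, ω.2 i)) = Measure.pi fun _ => (μ.prod ν).map f := by
  rw [← Measure.pi_map_pi fun _ => hf.aemeasurable,
    ← (measurePreserving_arrowProdEquivProdArrow S O (Fin b) (fun _ => μ) (fun _ => ν)).map_eq,
    Measure.map_map (by fun_prop) (MeasurableEquiv.measurable _)]
  rfl

/-- Noisy averages computed for the members of a batch are independent and identically
distributed. -/
lemma map_members_eq {ι Y Z : Type*} [Fintype ι] [MeasurableSpace Y] [MeasurableSpace Z]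
    (ν : Measure Z) [IsProbabilityMeasure ν] [NeZero n] {u : Fin n → Z → ι → ℝ}
    (hu : ∀ J, Measurable (u J)) (b : ℕ) {g : (Fin b → ι → ℝ) → Y} (hg : Measurable g) :
    ((Measure.pi fun _ : Fin b => (uniformOn (Set.univ : Set (Fin n))).prod ν).prod
      (Measure.pi fun _ => stdGauss ι)).map
        (fun ω => g fun i j => u (ω.1 i).1 (ω.1 i).2 j + ω.2 i j) =
      (Measure.pi fun _ => ν.bind fun z => averageLaw fun J => u J z).map g := by
  have := isProbabilityMeasure_uniform (NeZero.pos n)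
  have hu' : Measurable fun q : Fin n × Z => u q.1 q.2 :=
    measurable_from_prod_countable_right hu
  have hf : Measurable fun (q : (Fin n × Z) × (ι → ℝ)) j => u q.1.1 q.1.2 j + q.2 j := by
    fun_prop
  have hF : Measurable fun (q : (Fin b → Fin n × Z) × (Fin b → ι → ℝ)) i =>
      (fun j => u (q.1 i).1 (q.1 i).2 j + q.2 i j) :=
    measurable_pi_iff.2 fun i => hf.comp
      (f := fun q : (Fin b → Fin n × Z) × (Fin b → ι → ℝ) => (q.1 i, q.2 i)) (by fun_prop)
  rw [← map_member_eq_bind ν hu, ← map_prod_pi_eq _ _ b hf, Measure.map_map hg hF]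
  rfl

/-- Independent randomness with the same law on both sides may be conditioned on. -/
lemma RenyiClose.map_prod {X Y Z : Type*} [MeasurableSpace X] [MeasurableSpace Y]
    [MeasurableSpace Z] {p : ℝ} {C η : ℝ≥0∞} (hp : 1 ≤ p) (ν : Measure X) [IsProbabilityMeasure ν]
    (μ : Measure Y) [IsProbabilityMeasure μ] {f f' : X × Y → Z} (hf : Measurable f)
    (hf' : Measurable f')
    (h : ∀ x, RenyiClose p C η (μ.map fun y => f (x, y)) (μ.map fun y => f' (x, y))) :
    RenyiClose p C η ((ν.prod μ).map f) ((ν.prod μ).map f') := by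
  rw [map_prod_eq_bind _ _ hf, map_prod_eq_bind _ _ hf']
  exact RenyiClose.mixture hp ν (measurable_map_uncurry (f := fun x y => f (x, y)) _ hf)
    (measurable_map_uncurry (f := fun x y => f' (x, y)) _ hf')
    (fun x => Measure.isProbabilityMeasure_map (by fun_prop)) h

end Algorithm

section Privacy

variable {dX dW dΘ dZ nPub n : ℕ} {A : Config dX dW dΘ dZ} {p s : ℝ} {C η : ℝ≥0∞}

/-- The law of one noisy clipped private gradient, in units of the standard deviation of the
noise. -/
noncomputable def Config.memberLaw (A : Config dX dW dΘ dZ) (data : Fin n → Vec dX)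
    (s : NetState dW dΘ) (𝒢 : Grouping dW) : Measure (Fin dW → ℝ) :=
  (A.latent.prod (volume.restrict (Set.Icc (0 : ℝ) 1))).bind fun z =>
    averageLaw fun J => A.memberClip s 𝒢 (data J) z

lemma measurable_memberClip_right (hA : A.Regular) (s : NetState dW dΘ) (𝒢 : Grouping dW)
    (x : Vec dX) : Measurable (A.memberClip s 𝒢 x) :=
  (measurable_memberClip hA fun _ : Fin 1 => x).comp (f := fun z => ((s, 𝒢), ((0 : Fin 1), z)))
    (by fun_prop)

lemma isProbabilityMeasure_memberLaw (hA : A.Regular) [NeZero n] (data : Fin n → Vec dX)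
    (s : NetState dW dΘ) (𝒢 : Grouping dW) : IsProbabilityMeasure (A.memberLaw data s 𝒢) :=
  have := hA.latent_prob
  isProbabilityMeasure_bind
    (measurable_averageLaw fun J => measurable_memberClip_right hA s 𝒢 (data J)) fun _ =>
    inferInstance

/-- Given the public batch, a critic iteration post-processes the independent noisy clipped
gradients of the members of the private batch. -/
lemma map_criticStep_eq (hA : A.Regular) (hσ : A.σ ≠ 0) [NeZero n] (pub : Fin nPub → Vec dX)
    (data : Fin n → Vec dX) (s : NetState dW dΘ) (ω : BatchSeed nPub A.mPub dZ) :
    ((batchLaw n A.m A.latent).prod (noiseLaw A.m dW)).map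
      (fun ω' => A.criticStep pub data s (ω, ω')) =
    (Measure.pi fun _ : Fin A.m => A.memberLaw data s (A.grouping pub s.1.1 s.2.1 ω)).map
      (A.criticUpdate s (A.grouping pub s.1.1 s.2.1 ω)) := by
  have := hA.latent_prob
  have := isProbabilityMeasure_uniform (NeZero.pos n)
  set 𝒢 := A.grouping pub s.1.1 s.2.1 ω with h𝒢
  have hu := fun J => measurable_memberClip_right hA s 𝒢 (data J)
  have hg : Measurable (A.criticUpdate s 𝒢) :=
    Measurable.criticUpdate measurable_const measurable_const measurable_id
  unfold Config.memberLaw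
  rw [← map_members_eq _ hu A.m hg]
  simp_rw [criticStep_eq hσ]
  rfl

/-- One critic iteration inherits the divergence bound of the subsampled Gaussian mechanism with
rate `1 / n`, once for each member of the private batch. -/
lemma renyiClose_criticLaw (hA : A.Regular) (hσ : 0 < A.σ) (hPub : 0 < nPub) [NeZero n]
    (hp : 1 ≤ p) (hs : A.k / A.σ ^ 2 ≤ 1 / s ^ 2)
    (H : ∀ a b : Fin dW → ℝ, ∑ i, a i ^ 2 ≤ 4 / s ^ 2 → ∑ i, b i ^ 2 ≤ 4 / s ^ 2 →
      (1 / (n : ℝ) ≤ 1 / 2 ∨ b = 0) →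
      RenyiClose p C η (gaussMix (1 / n) a) (gaussMix (1 / n) b))
    (pub : Fin nPub → Vec dX) {data data' : Fin n → Vec dX} (hd : Adjacent data data')
    (x : NetState dW dΘ) :
    RenyiClose p (C ^ A.m) (A.m * η) (A.criticLaw pub data x) (A.criticLaw pub data' x) := by
  obtain ⟨j₀, hj⟩ := hd
  have := hA.latent_prob
  have := isProbabilityMeasure_batchLaw (NeZero.pos n) A.m A.latent
  have := isProbabilityMeasure_batchLaw hPub A.mPub A.latent
  have hstep : ∀ data : Fin n → Vec dX, Measurable (A.criticStep pub data x) := fun data => by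
    have h := (measurable_criticStep hA hσ.ne' pub data).comp (measurable_prodMk_left (x := x))
    exact h
  refine RenyiClose.map_prod hp _ _ (hstep data) (hstep data') fun ω => ?_
  rw [map_criticStep_eq hA hσ.ne', map_criticStep_eq hA hσ.ne']
  set 𝒢 := A.grouping pub x.1.1 x.2.1 ω
  have h𝒢 : IsGrouping 𝒢 := isGrouping_weightClustering _ fun i => paramBounds_nonneg _ i
  have hcard : (groupReps 𝒢).card ≤ A.k := card_groupReps_weightClustering hA.k_pos _
  have := isProbabilityMeasure_memberLaw hA data x 𝒢
  have := isProbabilityMeasure_memberLaw hA data' x 𝒢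
  have hg : Measurable (A.criticUpdate x 𝒢) :=
    Measurable.criticUpdate measurable_const measurable_const measurable_id
  have hclip : ∀ y z, ∑ i, A.memberClip x 𝒢 y z i ^ 2 ≤ 1 / s ^ 2 := fun y z =>
    (sum_sq_scaledClip_le hσ h𝒢 hcard _).trans hs
  have hmember : RenyiClose p C η (A.memberLaw data x 𝒢) (A.memberLaw data' x 𝒢) :=
    RenyiClose.mixture hp _
      (measurable_averageLaw fun J => measurable_memberClip_right hA x 𝒢 (data J))
      (measurable_averageLaw fun J => measurable_memberClip_right hA x 𝒢 (data' J))
      (fun z => inferInstance) fun z => renyiClose_averageLaw hp H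
        (u := fun J => A.memberClip x 𝒢 (data J) z) (u' := fun J => A.memberClip x 𝒢 (data' J) z)
        (j₀ := j₀) (fun J hJ => by rw [hj J hJ]) (fun J => hclip _ _) fun J => hclip _ _
  exact (RenyiClose.pi hp hmember A.m).map hg

lemma renyiClose_loopLaw (hA : A.Regular) (hσ : A.σ ≠ 0) (hn : 0 < n) (hPub : 0 < nPub)
    (hp : 1 ≤ p) (hC : 1 ≤ C) (pub : Fin nPub → Vec dX) {data data' : Fin n → Vec dX}
    (h : ∀ x, RenyiClose p C η (A.criticLaw pub data x) (A.criticLaw pub data' x))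
    (x : LoopState dW dΘ) :
    RenyiClose p (C ^ A.nCritic) (A.nCritic * η) (A.loopLaw pub data x)
      (A.loopLaw pub data' x) := by
  rw [loopLaw_eq, loopLaw_eq]
  split
  · exact (RenyiClose.refl hp _).mono (one_le_pow₀ hC) zero_le
  · refine RenyiClose.map ?_ ((measurable_closeRound hA).comp measurable_prodMk_left)
    have hκ := measurable_criticLaw hA hσ hn hPub pub data
    have hκ' := measurable_criticLaw hA hσ hn hPub pub data'
    have hprob := isProbabilityMeasure_criticLaw hA hσ hn hPub pub data
    have := isProbabilityMeasure_iterateLaw hκ hprob A.nCritic x.1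
    have hgen := isProbabilityMeasure_genLaw hA
    simpa [Config.roundLaw] using (RenyiClose.iterateLaw hp hκ hκ' hprob h A.nCritic x.1).bind hp
      (measurable_genLaw hA) (measurable_genLaw hA) hgen fun y => RenyiClose.refl hp (A.genLaw y)

/-- The whole algorithm composes `m * nCritic * t` subsampled Gaussian mechanisms. -/
lemma renyiClose_advancedDPGAN (hA : A.Regular) (hσ : 0 < A.σ) (hPub : 0 < nPub) [NeZero n]
    (hp : 1 ≤ p) (hC : 1 ≤ C) (hs : A.k / A.σ ^ 2 ≤ 1 / s ^ 2)
    (H : ∀ a b : Fin dW → ℝ, ∑ i, a i ^ 2 ≤ 4 / s ^ 2 → ∑ i, b i ^ 2 ≤ 4 / s ^ 2 →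
      (1 / (n : ℝ) ≤ 1 / 2 ∨ b = 0) →
      RenyiClose p C η (gaussMix (1 / n) a) (gaussMix (1 / n) b))
    (pub : Fin nPub → Vec dX) (t : ℕ) {data data' : Fin n → Vec dX} (hd : Adjacent data data') :
    RenyiClose p (C ^ (A.m * A.nCritic * t)) ((A.m * A.nCritic * t : ℕ) * η)
      (A.advancedDPGAN pub t data) (A.advancedDPGAN pub t data') := by
  have hn := NeZero.pos n
  have hL := measurable_loopLaw hA hσ.ne' hn hPub pub data
  have hL' := measurable_loopLaw hA hσ.ne' hn hPub pub data'
  have hprob := isProbabilityMeasure_loopLaw hA hσ.ne' hn hPub pub data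
  have hloop := renyiClose_loopLaw hA hσ.ne' hn hPub hp (one_le_pow₀ hC) pub
    (renyiClose_criticLaw hA hσ hPub hp hs H pub hd)
  have := isProbabilityMeasure_warmStart hA hPub pub
  refine ((RenyiClose.mixture hp (A.warmStart pub)
    ((measurable_iterateLaw hL t).comp measurable_loopStart)
    ((measurable_iterateLaw hL' t).comp measurable_loopStart)
    (fun x => isProbabilityMeasure_iterateLaw hL hprob t _)
    fun x => RenyiClose.iterateLaw hp hL hL' hprob hloop t _).map
      (f := fun x : LoopState dW dΘ => x.1.2.1) (by fun_prop)).mono ?_ ?_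
  · rw [← pow_mul, ← pow_mul, mul_assoc]
  · push_cast
    apply le_of_eq
    ring

/-- Without any critic iteration the private data are not used. -/
lemma advancedDPGAN_eq_of_no_updates (pub : Fin nPub → Vec dX) {t : ℕ} (h : A.nCritic * t = 0)
    (data data' : Fin n → Vec dX) : A.advancedDPGAN pub t data = A.advancedDPGAN pub t data' := by
  rcases Nat.mul_eq_zero.1 h with h | h
  · have : A.loopLaw pub data = A.loopLaw pub data' := by
      funext x
      simp only [loopLaw_eq, Config.roundLaw, h, iterateLaw]
    unfold Config.advancedDPGAN
    rw [this]
  · simp only [h, Config.advancedDPGAN, iterateLaw]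

end Privacy

/-! ### From divergence bounds to differential privacy -/

section Conversion

/-- A divergence bound of order `α` gives differential privacy with any exponent `E`, at the price
of the additive error `exp (v - (α - 1) E)`. -/
lemma RenyiClose.measure_le {Ω : Type*} [MeasurableSpace Ω] {α p v : ℝ} {η : ℝ≥0∞}
    (hpα : α.HolderConjugate p) {P Q : Measure Ω} [IsProbabilityMeasure Q]
    (h : RenyiClose p (ENNReal.ofReal (Real.exp (v / α))) η P Q) (E : ℝ) {S : Set Ω}
    (hS : MeasurableSet S) :
    P S ≤ ENNReal.ofReal (Real.exp E) * Q S + ENNReal.ofReal (Real.exp (v - (α - 1) * E)) + η := by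
  have hα := hpα.pos
  have hp := hpα.symm.pos
  have h1 := h (S.indicator 1) (measurable_one.indicator hS) fun x => by
    by_cases hx : x ∈ S <;> simp [hx]
  have e : ∀ x, S.indicator (1 : Ω → ℝ≥0∞) x ^ p = S.indicator 1 x := fun x => by
    by_cases hx : x ∈ S <;> simp [hx, hp]
  simp_rw [e] at h1
  rw [lintegral_indicator_one hS, lintegral_indicator_one hS] at h1
  refine h1.trans (add_le_add ?_ le_rfl)
  have hx : Q S = ENNReal.ofReal (Q.real S) := by simp
  set x := Q.real S
  have hx0 : 0 ≤ x := measureReal_nonneg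
  have hinv : 1 / p = 1 - 1 / α := by
    have := hpα.inv_add_inv_eq_one
    rw [one_div, one_div]; linarith
  rw [hx, ENNReal.ofReal_rpow_of_nonneg hx0 (by positivity),
    ← ENNReal.ofReal_mul (Real.exp_pos _).le, ← ENNReal.ofReal_mul (Real.exp_pos _).le,
    ← ENNReal.ofReal_add (by positivity) (by positivity)]
  apply ENNReal.ofReal_le_ofReal
  -- The left side is a weighted geometric mean of the two terms on the right.
  have hg := Real.geom_mean_le_arith_mean2_weighted (w₁ := 1 / p) (w₂ := 1 / α)
    (p₁ := Real.exp E * x) (p₂ := Real.exp (v - (α - 1) * E)) (by positivity) (by positivity)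
    (by positivity) (by positivity) (by rw [hinv]; ring)
  rw [Real.mul_rpow (Real.exp_pos _).le hx0, ← Real.exp_mul, ← Real.exp_mul] at hg
  have e2 : Real.exp (v / α) * x ^ (1 / p) =
      Real.exp (E * (1 / p)) * x ^ (1 / p) * Real.exp ((v - (α - 1) * E) * (1 / α)) := by
    rw [mul_right_comm, ← Real.exp_add, hinv]
    congr 2
    field_simp
    ring
  rw [e2]
  have hp1 : 1 / p ≤ 1 := by
    have : 0 ≤ 1 / α := by positivity
    linarith
  have hα1 : 1 / α ≤ 1 := by
    have : 0 ≤ 1 / p := by positivity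
    linarith
  refine hg.trans (add_le_add ?_ ?_)
  · exact mul_le_of_le_one_left (by positivity) hp1
  · exact mul_le_of_le_one_left (by positivity) hα1

lemma le_two_mul_log {δ : ℝ} (hδ0 : 0 < δ) (hδ1 : δ < 1) : 0.44 ≤ 2 * Real.log (1.25 / δ) := by
  have h1 : Real.log 1.25 ≤ Real.log (1.25 / δ) := by
    apply Real.log_le_log (by norm_num)
    rw [le_div_iff₀ hδ0]; linarith
  have h2 : 7 * Real.log 2 ≤ 22 * Real.log 1.25 := by
    have : Real.log ((2 : ℝ) ^ 7) ≤ Real.log ((1.25 : ℝ) ^ 22) :=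
      Real.log_le_log (by norm_num) (by norm_num)
    rw [Real.log_pow, Real.log_pow] at this
    exact_mod_cast this
  have := Real.log_two_gt_d9
  linarith

lemma exp_neg_two_mul_le {δ L : ℝ} (hδ0 : 0 < δ) (hδ1 : δ < 1)
    (hL : L ^ 2 = 2 * Real.log (1.25 / δ)) : Real.exp (-(2 * L ^ 2)) ≤ δ / 2 := by
  have h1 := le_two_mul_log hδ0 hδ1
  rw [← hL] at h1
  have h2 : Real.exp (-(L ^ 2 / 2)) = δ / 1.25 := by
    rw [hL, Real.exp_neg, show 2 * Real.log (1.25 / δ) / 2 = Real.log (1.25 / δ) by ring,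
      Real.exp_log (by positivity), inv_div]
  have h3 : Real.exp (-(3 / 2 * L ^ 2)) ≤ 0.625 := by
    rw [Real.exp_neg, inv_le_comm₀ (Real.exp_pos _) (by norm_num)]
    have := Real.add_one_le_exp (3 / 2 * L ^ 2)
    norm_num
    linarith
  calc Real.exp (-(2 * L ^ 2)) = Real.exp (-(3 / 2 * L ^ 2)) * Real.exp (-(L ^ 2 / 2)) := by
        rw [← Real.exp_add]; ring_nf
    _ ≤ 0.625 * (δ / 1.25) := by rw [h2]; gcongr
    _ = δ / 2 := by ring

/-- The absolute constant of the privacy guarantee. The first term absorbs the divergence of the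
composition. With `c = 1 / (256 exp 20)`, where `exp 20` is the factor in the truncation of
likelihood ratios at `exp 20 * √N`, the second term times `c` is `2`, which leaves `exp (-2 L²)`. -/
noncomputable def privacyConst : ℝ := Real.exp 14 + 512 * Real.exp 20

/-- Divergence bound for `N` subsampled Gaussian mechanisms that suffices for differential privacy.
If the target `q ε √N` is at least of the order of `log (1 / δ)`, the order `α = 2` will do;
otherwise `α` is a multiple of `log (1 / δ) / (q ε √N)`, and likelihood ratios beyond a multiple of
`√N` are discarded. -/
lemma exists_renyiClose_gaussMix {N : ℕ} (hN : 0 < N) {q s L ε δ : ℝ} (hq0 : 0 < q) (hq1 : q ≤ 1)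
    (hε : 0 < ε) (hδ0 : 0 < δ) (hδ1 : δ < 1) (hL0 : 0 ≤ L)
    (hL : L ^ 2 = 2 * Real.log (1.25 / δ)) (h1 : L ≤ s) (h2 : L ≤ ε * s)
    (h3 : q * √N ≤ ε * s ^ 2) :
    ∃ (p : ℝ) (C η : ℝ≥0∞), 1 ≤ p ∧ 1 ≤ C ∧
      (∀ (P : ℕ) (a b : Fin P → ℝ), ∑ i, a i ^ 2 ≤ 4 / s ^ 2 → ∑ i, b i ^ 2 ≤ 4 / s ^ 2 →
        (q ≤ 1 / 2 ∨ b = 0) → RenyiClose p C η (gaussMix q a) (gaussMix q b)) ∧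
      ∀ {Ω : Type} [MeasurableSpace Ω] (P Q : Measure Ω) [IsProbabilityMeasure Q],
        RenyiClose p (C ^ N) (N * η) P Q → ∀ S, MeasurableSet S →
          P S ≤ ENNReal.ofReal (Real.exp (privacyConst * (q * ε * √N))) * Q S +
            ENNReal.ofReal δ := by
  have hLsq : 0.44 ≤ L ^ 2 := hL ▸ le_two_mul_log hδ0 hδ1
  have hLpos : 0 < L := by
    rcases hL0.eq_or_lt with h | h
    · rw [← h] at hLsq; norm_num at hLsq
    · exact h
  have hs0 : 0 < s := hLpos.trans_le h1
  have hLs : L ^ 2 ≤ s ^ 2 := by gcongr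
  have hs : 0.44 ≤ s ^ 2 := hLsq.trans hLs
  have hδ := exp_neg_two_mul_le hδ0 hδ1 hL
  have hN0 : (0 : ℝ) < N := by exact_mod_cast hN
  have hN1 : (1 : ℝ) ≤ N := by exact_mod_cast hN
  set r := √(N : ℝ) with hr
  have hr0 : 0 < r := Real.sqrt_pos.2 hN0
  have hrr : r ^ 2 = N := Real.sq_sqrt hN0.le
  set E := q * ε * r with hE
  have hE0 : 0 < E := by positivity
  set c : ℝ := 1 / (256 * Real.exp 20) with hc
  have hc0 : 0 < c := by positivity
  have hcK : privacyConst * c = Real.exp 14 * c + 2 := by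
    rw [privacyConst, hc]; field_simp; ring
  -- `c` is the largest constant for which the truncation condition of `renyiClose_gaussMix_large`
  -- holds in the second case.
  rcases le_or_gt (c * L ^ 2) E with hcase | hcase
  · refine ⟨2, _, 0, one_le_two, ?_, fun P a b ha hb hq =>
      renyiClose_gaussMix_two hs ha hb hq0.le hq1 hq, ?_⟩
    · rw [ENNReal.one_le_ofReal]
      exact Real.one_le_exp (by positivity)
    · intro Ω _ P Q _ h S hS
      rw [mul_zero, ← ENNReal.ofReal_pow (Real.exp_pos _).le, ← Real.exp_nat_mul,
        ← mul_div_assoc] at h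
      refine (h.measure_le Real.HolderConjugate.two_two (privacyConst * E) hS).trans ?_
      rw [add_zero]
      gcongr
      refine le_trans (Real.exp_le_exp.2 ?_) (hδ.trans (by linarith))
      have hv : N * (q ^ 2 / s ^ 2) ≤ E := by
        rw [← mul_div_assoc, div_le_iff₀ (by positivity), ← hrr, hE]
        calc r ^ 2 * q ^ 2 = (q * r) * (q * r) := by ring
          _ ≤ (q * r) * (ε * s ^ 2) := by gcongr
          _ = _ := by ring
      have h5 : Real.exp 14 * (N * (q ^ 2 / s ^ 2)) ≤ Real.exp 14 * E := by gcongr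
      have h6 : 512 * Real.exp 20 * (c * L ^ 2) ≤ 512 * Real.exp 20 * E := by gcongr
      have h7 : 512 * Real.exp 20 * (c * L ^ 2) = 2 * L ^ 2 := by
        rw [hc]; field_simp; ring
      have h8 : privacyConst * E = Real.exp 14 * E + 512 * Real.exp 20 * E := by
        rw [privacyConst]; ring
      linarith
  · set α := 2 * c * L ^ 2 / E with hα
    have hαE : α * E = 2 * c * L ^ 2 := by rw [hα]; field_simp
    have hα2 : 2 < α := by
      rw [hα, lt_div_iff₀ hE0]; linarith
    have hpα : α.HolderConjugate (Real.conjExponent α) := .conjExponent (by linarith)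
    -- The threshold `exp 20 * √N` makes the discarded mass less than `exp (-2 L²) / N`.
    set ℓ := 20 + Real.log N / 2 with hℓ
    have hexpℓ : Real.exp ℓ = Real.exp 20 * r := by
      rw [hℓ, Real.exp_add, ← Real.log_sqrt hN0.le, Real.exp_log hr0]
    have hβ : 2 * α * q = 4 * c * L ^ 2 / (ε * r) := by
      rw [hα, hE]; field_simp; ring
    have hLε : L ^ 2 ≤ ε * s ^ 2 := by
      calc L ^ 2 = L * L := sq L
        _ ≤ (ε * s) * s := by gcongr
        _ = _ := by ring
    have hcond : 2 * (2 * α * q) * Real.exp ℓ ≤ s ^ 2 / 32 := by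
      rw [hβ, hexpℓ]
      have : 2 * (4 * c * L ^ 2 / (ε * r)) * (Real.exp 20 * r) = L ^ 2 / (32 * ε) := by
        rw [hc]; field_simp; ring
      rw [this, div_le_iff₀ (by positivity)]
      linarith
    refine ⟨Real.conjExponent α, _, _, hpα.symm.lt.le, ?_, fun P a b ha hb hq =>
      renyiClose_gaussMix_large hpα hs0 hs ha hb hq0.le hq1 hq hcond, ?_⟩
    · rw [ENNReal.one_le_ofReal]
      exact Real.one_le_exp (by have := hpα.pos; positivity)
    · intro Ω _ P Q _ h S hS
      rw [← ENNReal.ofReal_pow (Real.exp_pos _).le, ← Real.exp_nat_mul, ← mul_div_assoc,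
        ← ENNReal.ofReal_natCast, ← ENNReal.ofReal_mul hN0.le] at h
      refine (h.measure_le hpα (privacyConst * E) hS).trans ?_
      rw [add_assoc, ← ENNReal.ofReal_add (by positivity) (by positivity)]
      gcongr
      have h5 : Real.exp (N * (Real.exp 25 * ((2 * α * q) ^ 2 / s ^ 2)) -
          (α - 1) * (privacyConst * E)) ≤ δ / 2 := by
        refine le_trans (Real.exp_le_exp.2 ?_) hδ
        have hv : N * ((2 * α * q) ^ 2 / s ^ 2) ≤ 16 * c ^ 2 * L ^ 2 := by
          have : N * ((2 * α * q) ^ 2 / s ^ 2) =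
              16 * c ^ 2 * L ^ 2 * (L ^ 2 / (ε * s) ^ 2) := by
            rw [hβ, ← hrr]; field_simp; ring
          rw [this]
          refine mul_le_of_le_one_right (by positivity) ?_
          rw [div_le_one (by positivity)]
          gcongr
        have h6 : Real.exp 25 * (N * ((2 * α * q) ^ 2 / s ^ 2)) ≤
            Real.exp 25 * (16 * c ^ 2 * L ^ 2) := by gcongr
        have h7 : Real.exp 25 * (16 * c) ≤ Real.exp 14 := by
          have : Real.exp 25 = Real.exp 5 * Real.exp 20 := by rw [← Real.exp_add]; norm_num
          have h8 : Real.exp 5 ≤ Real.exp 14 := Real.exp_le_exp.2 (by norm_num)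
          have : Real.exp 25 * (16 * c) = Real.exp 5 / 16 := by
            rw [this, hc]; field_simp; ring
          rw [this]
          linarith [Real.exp_pos 5]
        have h9 : Real.exp 25 * (16 * c) * (c * L ^ 2) ≤ Real.exp 14 * (c * L ^ 2) := by gcongr
        have h10 : α / 2 * (privacyConst * E) ≤ (α - 1) * (privacyConst * E) := by
          have : 0 < privacyConst := by unfold privacyConst; positivity
          gcongr
          linarith
        have h11 : α / 2 * (privacyConst * E) = (privacyConst * c) * L ^ 2 := by
          linear_combination privacyConst / 2 * hαE
        rw [h11, hcK] at h10
        linarith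
      have h12 : N * Real.exp (50 * s ^ 2 + 10 - 5 * s ^ 2 * ℓ) ≤ δ / 2 := by
        refine le_trans ?_ hδ
        have hlog : 0 ≤ Real.log N := Real.log_nonneg hN1
        have : (N : ℝ) * Real.exp (50 * s ^ 2 + 10 - 5 * s ^ 2 * ℓ) =
            Real.exp (Real.log N + (50 * s ^ 2 + 10 - 5 * s ^ 2 * ℓ)) := by
          rw [Real.exp_add, Real.exp_log hN0]
        rw [this, Real.exp_le_exp, hℓ]
        nlinarith [mul_le_mul_of_nonneg_right hs hlog]
      linarith

end Conversion

end DPGAN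

theorem theorem2 :
    ∃ K : ℝ, 0 < K ∧
      ∀ (dX dW dΘ dZ nPub n t : ℕ) (A : DPGAN.Config dX dW dΘ dZ) (pub : Fin nPub → DPGAN.Vec dX)
        (q ε δ T : ℝ),
        A.Regular → 0 < nPub → 0 < n →
        q = (A.m : ℝ) / n → T = (A.nCritic : ℝ) * t →
        0 < ε → 0 < δ → δ < 1 →
        √A.k * √(2 * Real.log (1.25 / δ)) ≤ A.σ →
        √(A.k / A.m) * (√(2 * Real.log (1.25 / δ)) / ε) ≤ A.σ →
        √(A.k / A.m) * √(q * √T / ε) ≤ A.σ →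
        (∀ data : Fin n → DPGAN.Vec dX, IsProbabilityMeasure (A.advancedDPGAN pub t data)) ∧
          DPGAN.IsDP (fun data : Fin n → DPGAN.Vec dX => A.advancedDPGAN pub t data)
            (K * (q * ε * √T)) δ := by
  refine ⟨DPGAN.privacyConst, by unfold DPGAN.privacyConst; positivity, ?_⟩
  intro dX dW dΘ dZ nPub n t A pub q ε δ T hA hPub hn hq hT hε hδ0 hδ1 hσ1 hσ2 hσ3
  have hm : (0 : ℝ) < A.m := by exact_mod_cast hA.m_pos
  have hk : (0 : ℝ) < A.k := by exact_mod_cast hA.k_pos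
  have hn0 : (0 : ℝ) < n := by exact_mod_cast hn
  have hlog := DPGAN.le_two_mul_log hδ0 hδ1
  set L := √(2 * Real.log (1.25 / δ)) with hLdef
  have hL0 : 0 < L := Real.sqrt_pos.2 (by linarith)
  have hL : L ^ 2 = 2 * Real.log (1.25 / δ) := Real.sq_sqrt (by linarith)
  have hσ : 0 < A.σ := lt_of_lt_of_le (by positivity) hσ1
  have : NeZero n := ⟨hn.ne'⟩
  refine ⟨DPGAN.isProbabilityMeasure_advancedDPGAN hA hσ.ne' hn hPub pub t, ?_⟩
  intro d d' hd S hS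
  have hprob' := DPGAN.isProbabilityMeasure_advancedDPGAN hA hσ.ne' hn hPub pub t d'
  have hq0 : 0 < q := by rw [hq]; positivity
  rcases Nat.eq_zero_or_pos (A.nCritic * t) with h0 | h0
  · have hT0 : T = 0 := by rw [hT]; exact_mod_cast h0
    simp only [DPGAN.advancedDPGAN_eq_of_no_updates pub h0 d d', hT0, Real.sqrt_zero, mul_zero,
      Real.exp_zero, ENNReal.ofReal_one, one_mul]
    exact le_self_add
  -- Every member of a private batch counts as a mechanism of its own, with rate `1 / n`, noise
  -- multiplier `σ / √k` and privacy parameter `√m ε`.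
  have hsk : 0 < √(A.k : ℝ) := Real.sqrt_pos.2 hk
  have hsm : 0 < √(A.m : ℝ) := Real.sqrt_pos.2 hm
  have hkk : √(A.k : ℝ) ^ 2 = A.k := Real.sq_sqrt hk.le
  have hmm : √(A.m : ℝ) ^ 2 = A.m := Real.sq_sqrt hm.le
  have hN : 0 < A.m * A.nCritic * t := by
    rw [mul_assoc]; exact Nat.mul_pos hA.m_pos h0
  have hcast : ((A.m * A.nCritic * t : ℕ) : ℝ) = A.m * T := by
    rw [hT]; push_cast; ring
  have hsqrt : √((A.m * A.nCritic * t : ℕ) : ℝ) = √A.m * √T := by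
    rw [hcast, Real.sqrt_mul hm.le]
  rw [Real.sqrt_div hk.le] at hσ2 hσ3
  have h1 : L ≤ A.σ / √A.k := by
    rw [le_div_iff₀ hsk]; linarith
  have h2 : L ≤ √A.m * ε * (A.σ / √A.k) := by
    have e : √A.m * ε * (√A.k / √A.m * (L / ε) / √A.k) = L := by field_simp
    rw [← e]
    gcongr
  have h3 : 1 / (n : ℝ) * √((A.m * A.nCritic * t : ℕ) : ℝ) ≤
      √A.m * ε * (A.σ / √A.k) ^ 2 := by
    have hX : 0 ≤ q * √T / ε := by positivity
    have e : √A.m * ε * (√A.k / √A.m * √(q * √T / ε) / √A.k) ^ 2 =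
        1 / (n : ℝ) * √((A.m * A.nCritic * t : ℕ) : ℝ) := by
      rw [hsqrt, div_pow, mul_pow, div_pow, Real.sq_sqrt hX, hq]
      nth_rewrite 3 [← hmm]
      field_simp
    rw [← e]
    gcongr
  have hE : 1 / (n : ℝ) * (√A.m * ε) * √((A.m * A.nCritic * t : ℕ) : ℝ) = q * ε * √T := by
    rw [hsqrt, hq]
    nth_rewrite 3 [← hmm]
    ring
  obtain ⟨p, C, η, hp, hC, H, hconv⟩ := DPGAN.exists_renyiClose_gaussMix hN
    (show 0 < 1 / (n : ℝ) by positivity)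
    (by rw [div_le_one hn0]; exact_mod_cast hn) (mul_pos hsm hε) hδ0 hδ1 hL0.le hL h1 h2 h3
  rw [hE] at hconv
  refine hconv _ _ (DPGAN.renyiClose_advancedDPGAN hA hσ hPub hp hC (s := A.σ / √A.k) ?_
    (H dW) pub t hd) S hS
  rw [div_pow, hkk, one_div_div]
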